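/- **Setting.** Let $\theta\in\mathbb R$ with $\sin\theta\ne0$, $A=\begin{pmatrix}\cos\theta&\sin\theta\\-\sin\theta&\cos\theta\end{pmatrix}$, $b=(0,1)^T$. There are finitely many agents $i\in V$ with states $x^i(t)=(x_{i1}(t),x_{i2}(t))^T\in\mathbb R^2$, $$x^i(t+1)=Ax^i(t)+b\,u_i(t),\qquad y_i(t)=x_{i1}(t),\qquad t=0,1,2,\dots$$ They communicate over a directed graph without self-loops with weights $g_{iv}\ge 0$, where $g_{iv}>0$ if and only if $(v,i)$ is an edge ($i$ receives from $v$). The graph contains a spanning tree, i.e. some node has a directed path to every node. Let $L=\mathrm{diag}\big(\sum_v g_{iv}\big)-[g_{iv}]$ be the Laplacian, and let $w$ be the vector with $w^TL=0$ and $\sum_v w_v=1$. *Quantizer.* For $M\in\mathbb N^+$ let $q^{M}:\mathbb R\to\{-M,\dots,M\}$ be $q^M(y)=0$ for $|y|<\frac12$; $q^M(y)=j$ for $\frac{2j-1}2\le y<\frac{2j+1}2$, $1\le j\le M-1$; $q^M(y)=M$ for $y\ge\frac{2M-1}2$; $q^M(y)=-q^M(-y)$ for $y\le-\frac12$. At time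 $t$ the quantizer $q_t=q^{M(t)}$ is used. *Encoder.* With $p(t)=p_0\gamma^t$, agent $i$ emits the signals $s_i(t)$ and forms the estimates $\hat x_{i1}(t),\hat x_{i2}(t)$: - $s_i(t)=q_t\big(y_i(t)/p(t-1)\big)$ and $\hat x_{i1}(t)=p(t-1)s_i(t)$ for $t=1,2$; - for $t\ge3$, with $\pi_i(t)=\cos\theta\,\hat x_{i1}(t-1)+\sin\theta\,\hat x_{i2}(t-1)$: $s_i(t)=q_t\big((y_i(t)-\pi_i(t))/p(t-1)\big)$ and $\hat x_{i1}(t)=\pi_i(t)+p(t-1)s_i(t)$; - $\hat x_{i2}(t)=\cot\theta\,\hat x_{i1}(t)-\csc\theta\,\hat x_{i1}(t-1)$ for $t\ge2$. *Decoder.* Each out-neighbour $v$ of $i$ computes estimates $\hat x_{iv1},\hat x_{iv2}$ from the received signals $s_i$ by the same recursion. *Control.* $u_i(0)=u_i(1)=0$, and $u_i(t)=\sum_{j=1}^2k_j\sum_v g_{iv}\big[\hat x_{vij}(t)-\hat x_{ij}(t)\big]$ for $t\ge2$, with $k_j=\varepsilon c_j$, $c_1=-\sin\theta/h$, $c_2=\cos\theta/h$,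 where $h>0$ and $h\le\mathrm{Re}\,\lambda$ for every nonzero eigenvalue $\lambda$ of $L$. Put $\gamma=1-\varepsilon/4$. **Theorem.** There is $\varepsilon_0>0$, depending only on $\theta$, the weighted graph and $h$, such that for every $\varepsilon\in(0,\varepsilon_0)$ one has $0<\gamma<1$ and there is a constant $\kappa$ with the following property. Let $C^*,C_\delta^*>0$ and let the initial states satisfy $|x_{ij}(0)|\le C^*$ and $\big|x_{ij}(0)-\sum_v w_vx_{vj}(0)\big|\le C^*_\delta$ for all $i\in V$, $j=1,2$. If $$p_0\ge\max\Big\{\frac{4}{3\gamma}C^*,\,C_\delta^*\Big\},\qquad M(1),M(2)\ge1,\qquad M(t)\ge|\cos\theta|+\tfrac12\ \ (t\ge3),$$ then consensus is achieved at rate $O(\gamma^t)$: for all $i,v\in V$, $j=1,2$, $$\lim_{t\to\infty}\big[x_{ij}(t)-x_{vj}(t)\big]=0,\qquad |x_{ij}(t)-x_{vj}(t)|\le\kappa\,p_0\,\gamma^t\quad\text{for all }t\ge0.$$ The least number of quantization levels allowed at all times is $M(t)\equiv K=\lceil|\cos\theta|+\frac12\rceil$. If the signal $0$ is sent as silence,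 the least number $b$ for which all signals of $q^{K}$ can be sent as distinct messages, each being silence or one $b$-bit word, is $b=\big\lceil\log_2 2\lceil|\cos\theta|+\frac12\rceil\big\rceil$, and $b\le2$. -/

import Mathlib

open Filter Topology

namespace OscillatorConsensus

/-- A weighted directed graph without self-loops: `weight i v = g_{iv} ≥ 0`, and
`g_{iv} > 0` exactly when there is an edge from `v` to `i` (agent `i` hears agent `v`). -/
structure WeightedDigraph (V : Type*) where
  weight : V → V → ℝ
  weight_nonneg : ∀ i v, 0 ≤ weight i v
  weight_self : ∀ i, weight i i = 0

namespace WeightedDigraph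

variable {V : Type*}

/-- The directed edge `(v, i)`. -/
def Edge (G : WeightedDigraph V) (v i : V) : Prop := 0 < G.weight i v

/-- Some node (the root) is joined to every node by a directed path. -/
def HasSpanningTree (G : WeightedDigraph V) : Prop :=
  ∃ r : V, ∀ v : V, Relation.ReflTransGen G.Edge r v

/-- The Laplacian `L = diag(∑ᵥ g_{iv}) - [g_{iv}]`. -/
def laplacian [Fintype V] [DecidableEq V] (G : WeightedDigraph V) : Matrix V V ℝ :=
  Matrix.diagonal (fun i => ∑ v, G.weight i v) - Matrix.of G.weight

/-- `w` is the left null vector of the Laplacian normalized by `∑ᵥ wᵥ = 1`; then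
`x ↦ x - (∑ᵥ wᵥ xᵥ) 𝟏` is the disagreement map `I - φ₁ψ₁ᵀ` (`φ₁ = 𝟏/√N`, `ψ₁ = √N w`). -/
def IsLeftNullVector [Fintype V] [DecidableEq V] (G : WeightedDigraph V) (w : V → ℝ) : Prop :=
  Matrix.vecMul w G.laplacian = 0 ∧ ∑ v, w v = 1

end WeightedDigraph

noncomputable section

/-- The branch `y > -1/2` of the quantizer: `0` below `1/2`, `j` on `[(2j-1)/2, (2j+1)/2)` for
`1 ≤ j ≤ M - 1`, and `M` from `(2M-1)/2` on. -/
def quantizerPos (M : ℕ) (y : ℝ) : ℤ :=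
  if y < 1 / 2 then 0
  else if (2 * (M : ℝ) - 1) / 2 ≤ y then (M : ℤ)
  else ⌊y + 1 / 2⌋

/-- The uniform quantizer with `2M + 1` levels. -/
def quantizer (M : ℕ) (y : ℝ) : ℤ :=
  if y ≤ -(1 / 2) then -quantizerPos M (-y) else quantizerPos M y

/-- All outputs of the quantizer can be sent over a channel carrying at most one `b`-bit word per
time step: the output `0` is sent as silence (`none`), and different outputs are sent
differently. -/
def SignalsFitIn (M b : ℕ) : Prop :=
  ∃ msg : ℤ → Option (Fin b → Bool), msg 0 = none ∧ Set.InjOn msg (Set.range (quantizer M))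

/-- The rotation matrix of a harmonic oscillator. -/
def stateMatrix (θ : ℝ) : Matrix (Fin 2) (Fin 2) ℝ :=
  !![Real.cos θ, Real.sin θ; -Real.sin θ, Real.cos θ]

/-- The input vector. -/
def inputVector : Fin 2 → ℝ := ![0, 1]

/-- The parameters of the scheme: the angle `θ`, the control gains `k₁, k₂`, the scale
`p(t) = p₀ γ ^ t`, and the quantization levels `M(t)`. -/
structure Params where
  θ : ℝ
  gain : Fin 2 → ℝ
  p₀ : ℝ
  γ : ℝ
  M : ℕ → ℕ

namespace Params

variable (P : Params)

/-- The scaling function. -/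
def scale (t : ℕ) : ℝ := P.p₀ * P.γ ^ t

/-- The prediction of the output at time `t + 1` from the estimate at time `t`; there is none
(it is `0`) for the output at times `1` and `2`. -/
def predict (t : ℕ) (e : Fin 2 → ℝ) : ℝ :=
  if t + 1 ≤ 2 then 0 else Real.cos P.θ * e 0 + Real.sin P.θ * e 1

/-- The signal `s(t + 1)` an encoder with estimate `e` at time `t` emits on the output
`y = y(t + 1)`. -/
def encode (t : ℕ) (e : Fin 2 → ℝ) (y : ℝ) : ℤ :=
  quantizer (P.M (t + 1)) ((y - P.predict t e) / P.scale t)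

/-- The estimate at time `t + 1` from the estimate `e` at time `t` and the signal
`s = s(t + 1)`. It is used by the encoder and by all decoders. No estimate of the second
coordinate exists before time `2`; the value `0` put there is never used. -/
def update (t : ℕ) (e : Fin 2 → ℝ) (s : ℤ) : Fin 2 → ℝ :=
  let z : ℝ := P.predict t e + P.scale t * (s : ℝ)
  ![z, if t + 1 < 2 then 0 else Real.cos P.θ / Real.sin P.θ * z - e 0 / Real.sin P.θ]

end Params

/-- The network at a time `t`: `plant i = x^i(t)`; `est i` is the estimate of `x^i(t)` held by the
encoder of `i`; `dec i v` is the estimate of `x^i(t)` held by the decoder of `v`. -/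
structure NetworkState (V : Type*) where
  plant : V → Fin 2 → ℝ
  est : V → Fin 2 → ℝ
  dec : V → V → Fin 2 → ℝ

variable {V : Type*} [Fintype V]

/-- The control law. Only decoders of in-neighbours have a nonzero weight. -/
def control (G : WeightedDigraph V) (P : Params) (t : ℕ) (S : NetworkState V) (i : V) : ℝ :=
  if t ≤ 1 then 0
  else ∑ j : Fin 2, P.gain j * ∑ v, G.weight i v * (S.dec v i j - S.est i j)

/-- The states of the agents at time `t + 1`. -/
def nextPlant (G : WeightedDigraph V) (P : Params) (t : ℕ) (S : NetworkState V) (i : V) :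
    Fin 2 → ℝ :=
  Matrix.mulVec (stateMatrix P.θ) (S.plant i) + control G P t S i • inputVector

/-- The signal `s_i(t + 1)`, computed from the output `y_i(t + 1) = x_{i1}(t + 1)`. -/
def nextSignal (G : WeightedDigraph V) (P : Params) (t : ℕ) (S : NetworkState V) (i : V) : ℤ :=
  P.encode t (S.est i) (nextPlant G P t S i 0)

/-- The closed loop started from the states `x₀`. No signal has been sent at time `0`; the initial
estimates `0` are placeholders, as estimates start at time `1` without a prediction. -/
def closedLoop (G : WeightedDigraph V) (P : Params) (x₀ : V → Fin 2 → ℝ) : ℕ → NetworkState V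
  | 0 => { plant := x₀, est := 0, dec := 0 }
  | t + 1 =>
    let S := closedLoop G P x₀ t
    { plant := nextPlant G P t S
      est := fun i => P.update t (S.est i) (nextSignal G P t S i)
      dec := fun i v => P.update t (S.dec i v) (nextSignal G P t S i) }

/-- The gains `k_j = ε c_j` with `c₁ = -sin θ / h`, `c₂ = cos θ / h`, the rate `γ = 1 - ε / 4`. -/
def smallGainParams (θ h ε p₀ : ℝ) (M : ℕ → ℕ) : Params where
  θ := θ
  gain := ![ε * (-Real.sin θ / h), ε * (Real.cos θ / h)]
  p₀ := p₀
  γ := 1 - ε / 4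
  M := M

end

end OscillatorConsensus

/-! The difficulty is circular. Disagreements decay like `γ ^ t` only if the estimation errors do,
which needs unsaturated quantizers; saturation is avoided only if the control is small, hence only
if the disagreements decay. The loop closes because the decay constant does not depend on `ε`, while
the control carries a factor `ε`.

Decay: the undamped rotation has eigenvalues `exp (± I θ)`. Damping of size `ε μ` acts on one
coordinate only, so in the eigencoordinates it becomes damping `ε μ / 2` plus a coupling of order
`ε`. As `sin θ ≠ 0` the eigenvalues differ, and a change of variables `ε`-close to the identity
removes this coupling up to `ε ^ 2` (`norm_decoupled_step_le`). The contraction `1 - ε / 2 + O(ε ^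
2)` beats `γ = 1 - ε / 4` by enough to absorb a forcing of order `ε γ ^ t`. For the network no
Jordan form is needed: Cayley-Hamilton gives a product of factors `L - μ` over nonzero eigenvalues
that kills all disagreement vectors, and the factors are peeled off one at a time
(`exists_damped_network_bound`).

No saturation: the prediction error is `2 cos θ e(t+1) - e(t) + sin θ u(t)`, where `e` is the output
error. Errors of at most half the scale make it about `|cos θ| + 1/2` scales, while saturation
starts no earlier than at `|cos θ| + 1`. The margin pays for the control and the shrinking scale.
Strong induction on time joins both halves (`exists_disagreement_bound_of_unsaturated`). -/

namespace OscillatorConsensus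

/-! ### Quantizer error and counting of signals -/

theorem abs_sub_quantizerPos_le {M : ℕ} {y : ℝ} (hy : -(1 / 2) ≤ y)
    (hyM : y ≤ (M : ℝ) + 1 / 2) : |y - quantizerPos M y| ≤ 1 / 2 := by
  unfold quantizerPos
  split_ifs with h₁ h₂
  · rw [abs_le]; push_cast; constructor <;> linarith
  · rw [abs_le]; push_cast; constructor <;> linarith
  · have h₃ := Int.floor_le (y + 1 / 2)
    have h₄ := Int.lt_floor_add_one (y + 1 / 2)
    rw [abs_le]; constructor <;> linarith

/-- An unsaturated quantizer rounds with error at most `1 / 2`. -/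
theorem abs_sub_quantizer_le {M : ℕ} {y : ℝ} (hy : |y| ≤ (M : ℝ) + 1 / 2) :
    |y - quantizer M y| ≤ 1 / 2 := by
  rw [abs_le] at hy
  unfold quantizer
  split_ifs with h
  · have := abs_sub_quantizerPos_le (M := M) (y := -y) (by linarith) (by linarith)
    rw [← abs_neg]; push_cast
    convert this using 2; ring
  · exact abs_sub_quantizerPos_le (by linarith) hy.2

theorem quantizerPos_mem {M : ℕ} {y : ℝ} :
    quantizerPos M y ∈ Set.Icc (0 : ℤ) M := by
  unfold quantizerPos
  split_ifs with h₁ h₂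
  · simp
  · simp
  · refine ⟨Int.floor_nonneg.2 (by linarith), Int.lt_add_one_iff.1 (Int.floor_lt.2 ?_)⟩
    push_cast; linarith

theorem quantizer_mem {M : ℕ} {y : ℝ} :
    quantizer M y ∈ Set.Icc (-(M : ℤ)) M := by
  unfold quantizer
  split_ifs
  · obtain ⟨h₁, h₂⟩ := quantizerPos_mem (M := M) (y := -y)
    constructor <;> linarith
  · obtain ⟨h₁, h₂⟩ := quantizerPos_mem (M := M) (y := y)
    constructor <;> linarith

theorem quantizerPos_intCast {M : ℕ} {z : ℤ} (h₀ : 0 ≤ z) (hz : z ≤ M) :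
    quantizerPos M z = z := by
  unfold quantizerPos
  split_ifs with h₁ h₂
  · by_contra h
    have : (1 : ℤ) ≤ z := by omega
    have : (1 : ℝ) ≤ z := by exact_mod_cast this
    linarith
  · by_contra h
    have : z + 1 ≤ (M : ℤ) := by omega
    have : (z : ℝ) + 1 ≤ (M : ℝ) := by exact_mod_cast this
    linarith
  · rw [Int.floor_eq_iff]; constructor <;> linarith

theorem quantizer_intCast {M : ℕ} {z : ℤ} (hz : z ∈ Set.Icc (-(M : ℤ)) M) :
    quantizer M z = z := by
  obtain ⟨h₁, h₂⟩ := hz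
  unfold quantizer
  split_ifs with h
  · have hz : (z : ℝ) < 0 := by linarith
    have hz : z < 0 := by exact_mod_cast hz
    have := quantizerPos_intCast (M := M) (z := -z) (by omega) (by omega)
    push_cast at this
    rw [this]; ring
  · refine quantizerPos_intCast ?_ h₂
    by_contra h₀
    have : z ≤ -1 := by omega
    have : (z : ℝ) ≤ -1 := by exact_mod_cast this
    linarith

theorem range_quantizer (M : ℕ) :
    Set.range (quantizer M) = Set.Icc (-(M : ℤ)) M := by
  ext z
  constructor
  · rintro ⟨y, rfl⟩
    exact quantizer_mem
  · intro hz
    exact ⟨z, quantizer_intCast hz⟩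

/-- The `2M` nonzero signals need `2M` different words. -/
theorem signalsFitIn_iff {M b : ℕ} : SignalsFitIn M b ↔ 2 * M ≤ 2 ^ b := by
  unfold SignalsFitIn
  rw [range_quantizer M]
  have hwords : Fintype.card (Fin b → Bool) = 2 ^ b := by simp
  have hcard : (Finset.Icc (-(M : ℤ)) M).card = 2 * M + 1 := by rw [Int.card_Icc]; omega
  rw [← hwords]
  constructor
  · rintro ⟨msg, -, hinj⟩
    rw [← Finset.coe_Icc] at hinj
    have := Finset.card_le_card_of_injOn msg (t := Finset.univ) (fun _ _ => by simp) hinj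
    rw [hcard, Finset.card_univ, Fintype.card_option] at this
    omega
  · intro hb
    set s : Finset ℤ := (Finset.Icc (-(M : ℤ)) M).erase 0 with hs
    have hs0 : (0 : ℤ) ∉ s := Finset.notMem_erase _ _
    have hscard : Fintype.card s ≤ Fintype.card (Fin b → Bool) := by
      have h0 : (0 : ℤ) ∈ Finset.Icc (-(M : ℤ)) M := by simp
      rwa [Fintype.card_coe, hs, Finset.card_erase_of_mem h0, hcard, Nat.add_sub_cancel]
    obtain ⟨f⟩ := Function.Embedding.nonempty_of_card_le hscard
    refine ⟨fun z => if hz : z ∈ s then some (f ⟨z, hz⟩) else none, dif_neg hs0, ?_⟩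
    intro z hz z' hz' h
    rw [← Finset.coe_Icc, Finset.mem_coe] at hz hz'
    have hmem : ∀ y ∈ Finset.Icc (-(M : ℤ)) M, y ∉ s → y = 0 := fun y hy hys => by
      by_contra hy0
      exact hys (Finset.mem_erase.2 ⟨hy0, hy⟩)
    by_cases h₁ : z ∈ s <;> by_cases h₂ : z' ∈ s
    · simpa [h₁, h₂] using h
    · simp [h₁, h₂] at h
    · simp [h₁, h₂] at h
    · rw [hmem z hz h₁, hmem z' hz' h₂]

theorem isLeast_signalsFitIn {M : ℕ} (hM : 1 ≤ M) :
    IsLeast {b : ℕ | SignalsFitIn M b} ⌈Real.logb 2 (2 * (M : ℝ))⌉₊ := by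
  have hpos : (0 : ℝ) < 2 * (M : ℝ) := by
    have : (1 : ℝ) ≤ M := by exact_mod_cast hM
    linarith
  have key : ∀ b : ℕ, SignalsFitIn M b ↔ ⌈Real.logb 2 (2 * (M : ℝ))⌉₊ ≤ b := fun b => by
    rw [signalsFitIn_iff, Nat.ceil_le, Real.logb_le_iff_le_rpow (by norm_num) hpos,
      Real.rpow_natCast]
    exact_mod_cast Iff.rfl
  exact ⟨(key _).2 le_rfl, fun b hb => (key b).1 hb⟩

theorem abs_cos_lt_one {θ : ℝ} (hθ : Real.sin θ ≠ 0) : |Real.cos θ| < 1 := by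
  rw [← sq_lt_one_iff_abs_lt_one]
  have := Real.sin_sq_add_cos_sq θ
  have : 0 < Real.sin θ ^ 2 := by positivity
  linarith

/-- Since `0 < |cos θ| + 1/2 < 2`, the least level is `1` or `2`, so at most four nonzero signals
occur and two bits suffice. The constraint `1 ≤ K` comes from times `1` and `2`. -/
theorem quantization_levels {θ : ℝ} (hθ : Real.sin θ ≠ 0) :
    IsLeast {K : ℕ | 1 ≤ K ∧ |Real.cos θ| + 1 / 2 ≤ (K : ℝ)} ⌈|Real.cos θ| + 1 / 2⌉₊ ∧
      IsLeast {b : ℕ | SignalsFitIn ⌈|Real.cos θ| + 1 / 2⌉₊ b}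
        ⌈Real.logb 2 (2 * (⌈|Real.cos θ| + 1 / 2⌉₊ : ℝ))⌉₊ ∧
      ⌈Real.logb 2 (2 * (⌈|Real.cos θ| + 1 / 2⌉₊ : ℝ))⌉₊ ≤ 2 := by
  have h₁ : 1 ≤ ⌈|Real.cos θ| + 1 / 2⌉₊ := Nat.ceil_pos.2 (by positivity)
  have h₂ : ⌈|Real.cos θ| + 1 / 2⌉₊ ≤ 2 :=
    Nat.ceil_le.2 (by push_cast; linarith [abs_cos_lt_one hθ])
  refine ⟨⟨⟨h₁, Nat.le_ceil _⟩, fun K hK => Nat.ceil_le.2 hK.2⟩, isLeast_signalsFitIn h₁, ?_⟩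
  refine (isLeast_signalsFitIn h₁).2 (signalsFitIn_iff.2 ?_)
  omega

/-! ### Weakly damped and forced rotations -/

section DampedRotation

variable {E : Type*} [NormedAddCommGroup E] [NormedSpace ℂ E]

/-- The square of the right side exceeds that of the left by exactly `(m.re - ‖m‖ ^ 2 / 2) ^ 2`. -/
theorem norm_one_sub_le {m : ℂ} (hm : m.re ≤ 1) : ‖1 - m‖ ≤ 1 - m.re + ‖m‖ ^ 2 / 2 := by
  have h₀ : 0 ≤ 1 - m.re + ‖m‖ ^ 2 / 2 := by
    have := sq_nonneg ‖m‖
    linarith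
  refine abs_le_of_sq_le_sq' ?_ h₀ |>.2
  have e₁ : ‖1 - m‖ ^ 2 = (1 - m.re) ^ 2 + m.im ^ 2 := by
    rw [← Complex.normSq_eq_norm_sq, Complex.normSq_apply]; simp; ring
  have e₂ : ‖m‖ ^ 2 = m.re ^ 2 + m.im ^ 2 := by
    rw [← Complex.normSq_eq_norm_sq, Complex.normSq_apply]; ring
  rw [e₁, e₂]
  nlinarith [sq_nonneg (m.re - (m.re ^ 2 + m.im ^ 2) / 2)]

/-- One step of two weakly coupled rotations, in the coordinate `P = ζ + εκη` which removes the
coupling to first order. -/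
theorem norm_decoupled_step_le {a b m κ : ℂ} {ε : ℝ} (hε : 0 < ε) (ha : ‖a‖ = 1) (hb : ‖b‖ = 1)
    (hκ : κ * (b - a) = -(m * b)) (hm : 1 / 2 ≤ m.re) (hεm : ε * m.re ≤ 1)
    (hεκ : ε * ‖κ‖ ≤ 1 / 2) {ζ η ζ' η' g g' : E} {r : ℝ}
    (hζ : ζ' = ((1 - ε * m) * a) • ζ + (ε * m * b) • η + (ε : ℂ) • g)
    (hη : η' = ((1 - ε * m) * b) • η + (ε * m * a) • ζ + (ε : ℂ) • g')
    (hr : ‖ζ‖ ≤ 2 * r) (hr' : ‖η‖ ≤ 2 * r) (hP : ‖ζ + (ε * κ) • η‖ ≤ r)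
    {f : ℝ} (hg : ‖g‖ ≤ f) (hg' : ‖g'‖ ≤ f) :
    ‖ζ' + (ε * κ) • η'‖ ≤
      (1 - ε / 2 + ε ^ 2 * (‖m‖ ^ 2 / 2 + 6 * ‖κ‖ * ‖m‖)) * r + 2 * ε * f := by
  -- The choice of `κ` cancels the terms of order `ε` in `η`; only a coupling of order `ε ^ 2`
  -- remains.
  have hid : ζ' + (ε * κ) • η' = ((1 - ε * m) * a) • (ζ + (ε * κ) • η)
      + (ε ^ 2 * κ * m : ℂ) • (a • η + a • ζ - b • η) + ((ε : ℂ) • g + (ε * (ε * κ) : ℂ) • g') := by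
    rw [hζ, hη]
    linear_combination (norm := module) ((ε : ℂ) • hκ) • η
  have hr0 : 0 ≤ r := (norm_nonneg _).trans hP
  have hf : 0 ≤ f := (norm_nonneg _).trans hg
  have n₁ : ‖(1 - ε * m : ℂ)‖ ≤ 1 - ε / 2 + ε ^ 2 * (‖m‖ ^ 2 / 2) := by
    have h := norm_one_sub_le (m := ε * m) (by simpa using hεm)
    have hn : ‖(ε * m : ℂ)‖ = ε * ‖m‖ := by
      rw [norm_mul, Complex.norm_real, Real.norm_of_nonneg hε.le]
    have hre : (ε * m : ℂ).re = ε * m.re := by simp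
    rw [hn, hre] at h
    nlinarith
  have n₂ : ‖((1 - ε * m) * a) • (ζ + (ε * κ) • η)‖ ≤ (1 - ε / 2 + ε ^ 2 * (‖m‖ ^ 2 / 2)) * r := by
    rw [norm_smul, norm_mul, ha, mul_one]
    exact mul_le_mul n₁ hP (norm_nonneg _) ((norm_nonneg _).trans n₁)
  have n₃ : ‖a • η + a • ζ - b • η‖ ≤ 6 * r := by
    refine (norm_sub_le _ _).trans ?_
    have := norm_add_le (a • η) (a • ζ)
    simp only [norm_smul, ha, hb, one_mul] at this ⊢
    linarith
  have n₄ : ‖(ε ^ 2 * κ * m : ℂ) • (a • η + a • ζ - b • η)‖ ≤ ε ^ 2 * ‖κ‖ * ‖m‖ * (6 * r) := by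
    rw [norm_smul]
    simp only [norm_mul, norm_pow, Complex.norm_real, Real.norm_of_nonneg hε.le]
    gcongr
  have n₅ : ‖(ε : ℂ) • g + (ε * (ε * κ) : ℂ) • g'‖ ≤ 2 * ε * f := by
    refine (norm_add_le _ _).trans ?_
    simp only [norm_smul, norm_mul, Complex.norm_real, Real.norm_of_nonneg hε.le]
    have k₁ : ε * ‖g‖ ≤ ε * f := by gcongr
    have k₂ : ε * (ε * ‖κ‖) * ‖g'‖ ≤ ε * 1 * f := by
      gcongr
      linarith
    linarith
  rw [hid]
  have := norm_add₃_le (a := ((1 - ε * m) * a) • (ζ + (ε * κ) • η))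
    (b := (ε ^ 2 * κ * m : ℂ) • (a • η + a • ζ - b • η))
    (c := ((ε : ℂ) • g + (ε * (ε * κ) : ℂ) • g'))
  nlinarith

/-- A weakly damped and weakly forced rotation decays at the rate of the forcing, with a constant
independent of the strength `ε` of damping and forcing. -/
theorem exists_damped_rotation_bound {θ : ℝ} (hθ : Real.sin θ ≠ 0) {μ : ℂ} (hμ : 1 ≤ μ.re) :
    ∃ C ε₀ : ℝ, 0 ≤ C ∧ 0 < ε₀ ∧ ∀ ε : ℝ, 0 < ε → ε < ε₀ →
      ∀ (X Y F : ℕ → E) (T : ℕ) (B : ℝ),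
      (∀ t < T, X (t + 1) = (Real.cos θ : ℂ) • X t + (Real.sin θ : ℂ) • Y t) →
      (∀ t < T, Y (t + 1) = (1 - ε * μ) •
        (-(Real.sin θ : ℂ) • X t + (Real.cos θ : ℂ) • Y t) + (ε : ℂ) • F t) →
      ‖X 0‖ ≤ B → ‖Y 0‖ ≤ B → (∀ t < T, ‖F t‖ ≤ B * (1 - ε / 4) ^ t) →
      ∀ t ≤ T, ‖X t‖ ≤ C * B * (1 - ε / 4) ^ t ∧ ‖Y t‖ ≤ C * B * (1 - ε / 4) ^ t := by
  set c : ℂ := (Real.cos θ : ℂ) with hc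
  set s : ℂ := (Real.sin θ : ℂ) with hs
  have hs0 : s ≠ 0 := by rw [hs]; exact_mod_cast hθ
  set a : ℂ := c - Complex.I * s with ha_def
  set b : ℂ := c + Complex.I * s with hb_def
  have hI : Complex.I ^ 2 = -1 := Complex.I_sq
  have hba : b - a ≠ 0 := by
    rw [ha_def, hb_def]
    have : c + Complex.I * s - (c - Complex.I * s) = 2 * Complex.I * s := by ring
    rw [this]
    simp [hs0]
  have ha : ‖a‖ = 1 := by
    rw [← sq_eq_sq₀ (norm_nonneg _) zero_le_one, ← Complex.normSq_eq_norm_sq, Complex.normSq_apply,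
      ha_def, hc, hs]
    simp [-Complex.ofReal_cos, -Complex.ofReal_sin]
    nlinarith [Real.cos_sq_add_sin_sq θ]
  have hb : ‖b‖ = 1 := by
    rw [← sq_eq_sq₀ (norm_nonneg _) zero_le_one, ← Complex.normSq_eq_norm_sq, Complex.normSq_apply,
      hb_def, hc, hs]
    simp [-Complex.ofReal_cos, -Complex.ofReal_sin]
    nlinarith [Real.cos_sq_add_sin_sq θ]
  set m : ℂ := μ / 2 with hm_def
  have hm : 1 / 2 ≤ m.re := by
    have : m.re = μ.re / 2 := by rw [hm_def]; simp
    rw [this]; linarith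
  -- Solvable because the two rotation eigenvalues differ; `κ'` is the same with `a` and `b`
  -- exchanged.
  obtain ⟨κ, hκ⟩ : ∃ κ : ℂ, κ * (b - a) = -(m * b) := ⟨-(m * b) / (b - a), by field_simp⟩
  obtain ⟨κ', hκ'⟩ : ∃ κ' : ℂ, κ' * (a - b) = -(m * a) :=
    ⟨-(m * a) / (a - b), by
      have : a - b ≠ 0 := by rw [← neg_sub]; exact neg_ne_zero.2 hba
      field_simp⟩
  set D : ℝ := ‖κ‖ + ‖κ'‖ with hD
  set R : ℝ := ‖m‖ ^ 2 / 2 + 6 * D * ‖m‖ with hR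
  have hκD : ‖κ‖ ≤ D := by have := norm_nonneg κ'; linarith
  have hκD' : ‖κ'‖ ≤ D := by have := norm_nonneg κ; linarith
  have hD0 : 0 ≤ D := (norm_nonneg _).trans hκD
  have hR0 : 0 ≤ R := by positivity
  have hε₀ : 0 < 8 * R + 2 * D + m.re + 1 := by positivity
  -- The bound on `ε` gives `ε R ≤ 1/8`, `ε D ≤ 1/2`, `ε m.re ≤ 1` and `ε ≤ 1` at once. The constant
  -- is `32 = 2 * 16`: the decoupled coordinates stay below `16 B γ ^ t`, and undoing the change of
  -- variables costs a factor `2`.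
  refine ⟨32, 1 / (8 * R + 2 * D + m.re + 1), by norm_num, by positivity, ?_⟩
  intro ε hε hlt X Y F T B hX hY hX0 hY0 hF
  have hlt : ε * (8 * R + 2 * D + m.re + 1) < 1 := by rwa [lt_div_iff₀ hε₀] at hlt
  have hεR : 8 * (ε * R) ≤ 1 := by nlinarith [mul_nonneg hε.le hD0, mul_pos hε (by linarith : 0 < m.re)]
  have hεD : ε * D ≤ 1 / 2 := by nlinarith [mul_nonneg hε.le hR0, mul_pos hε (by linarith : 0 < m.re)]
  have hεm : ε * m.re ≤ 1 := by nlinarith [mul_nonneg hε.le hR0, mul_nonneg hε.le hD0]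
  have hε1 : ε ≤ 1 := by
    nlinarith [mul_nonneg hε.le hR0, mul_nonneg hε.le hD0, mul_pos hε (by linarith : 0 < m.re)]
  have hB : 0 ≤ B := (norm_nonneg _).trans hX0
  have hγ : 0 < 1 - ε / 4 := by linarith
  have hεκ : ε * ‖κ‖ ≤ 1 / 2 := (mul_le_mul_of_nonneg_left hκD hε.le).trans hεD
  have hεκ' : ε * ‖κ'‖ ≤ 1 / 2 := (mul_le_mul_of_nonneg_left hκD' hε.le).trans hεD
  have hnκ : ∀ k : ℂ, ∀ v : E, ‖((ε : ℂ) * k) • v‖ = ε * ‖k‖ * ‖v‖ := fun k v => by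
    rw [norm_smul, norm_mul, Complex.norm_real, Real.norm_of_nonneg hε.le]
  set ζ : ℕ → E := fun t => X t + Complex.I • Y t with hζ
  set η : ℕ → E := fun t => X t - Complex.I • Y t with hη
  have hζs : ∀ t < T, ζ (t + 1) = ((1 - ε * m) * a) • ζ t + (ε * m * b) • η t
      + (ε : ℂ) • (Complex.I • F t) := fun t ht => by
    simp only [hζ, hη, hX t ht, hY t ht, ha_def, hb_def, hm_def]
    linear_combination (norm := module) (s • hI) • Y t
  have hηs : ∀ t < T, η (t + 1) = ((1 - ε * m) * b) • η t + (ε * m * a) • ζ t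
      + (ε : ℂ) • (-Complex.I • F t) := fun t ht => by
    simp only [hζ, hη, hX t ht, hY t ht, ha_def, hb_def, hm_def]
    linear_combination (norm := module) (s • hI) • Y t
  have hsplit : ∀ t r, ‖ζ t + (ε * κ) • η t‖ ≤ r → ‖η t + (ε * κ') • ζ t‖ ≤ r →
      ‖ζ t‖ ≤ 2 * r ∧ ‖η t‖ ≤ 2 * r := fun t r h₁ h₂ => by
    have k₁ : ‖ζ t‖ ≤ r + ε * ‖κ‖ * ‖η t‖ := by
      have := norm_sub_le (ζ t + (ε * κ) • η t) ((ε * κ) • η t)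
      rw [add_sub_cancel_right, hnκ] at this
      linarith
    have k₂ : ‖η t‖ ≤ r + ε * ‖κ'‖ * ‖ζ t‖ := by
      have := norm_sub_le (η t + (ε * κ') • ζ t) ((ε * κ') • ζ t)
      rw [add_sub_cancel_right, hnκ] at this
      linarith
    have k₃ := mul_le_mul_of_nonneg_right hεκ (norm_nonneg (η t))
    have k₄ := mul_le_mul_of_nonneg_right hεκ' (norm_nonneg (ζ t))
    constructor <;> linarith
  have main : ∀ t ≤ T, ‖ζ t + (ε * κ) • η t‖ ≤ 16 * B * (1 - ε / 4) ^ t ∧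
      ‖η t + (ε * κ') • ζ t‖ ≤ 16 * B * (1 - ε / 4) ^ t := by
    intro t
    induction t with
    | zero =>
      intro _
      have k₁ : ‖ζ 0‖ ≤ 2 * B := by
        refine (norm_add_le _ _).trans ?_
        rw [norm_smul, Complex.norm_I]; linarith
      have k₂ : ‖η 0‖ ≤ 2 * B := by
        refine (norm_sub_le _ _).trans ?_
        rw [norm_smul, Complex.norm_I]; linarith
      constructor
      · refine (norm_add_le _ _).trans ?_
        rw [hnκ, pow_zero]
        have := mul_le_mul hεκ k₂ (norm_nonneg _) (by norm_num)
        linarith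
      · refine (norm_add_le _ _).trans ?_
        rw [hnκ, pow_zero]
        have := mul_le_mul hεκ' k₁ (norm_nonneg _) (by norm_num)
        linarith
    | succ t ih =>
      intro ht
      obtain ⟨h₁, h₂⟩ := ih (by omega)
      obtain ⟨h₃, h₄⟩ := hsplit t _ h₁ h₂
      have hFt := hF t (by omega)
      have hp : 0 < (1 - ε / 4) ^ t := pow_pos hγ t
      have hg₁ : ‖Complex.I • F t‖ ≤ B * (1 - ε / 4) ^ t := by
        rwa [norm_smul, Complex.norm_I, one_mul]
      have hg₂ : ‖-Complex.I • F t‖ ≤ B * (1 - ε / 4) ^ t := by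
        rwa [norm_smul, norm_neg, Complex.norm_I, one_mul]
      -- The constant `16` closes the induction: `16 (1 - ε/2 + ε/8) + 2 ε = 16 (1 - ε/4)`.
      have hfin : ∀ k : ℝ, 0 ≤ k → k ≤ D →
          (1 - ε / 2 + ε ^ 2 * (‖m‖ ^ 2 / 2 + 6 * k * ‖m‖)) * (16 * B * (1 - ε / 4) ^ t)
            + 2 * ε * (B * (1 - ε / 4) ^ t) ≤ 16 * B * (1 - ε / 4) ^ (t + 1) := by
        intro k _ hk
        have e₁ : ‖m‖ ^ 2 / 2 + 6 * k * ‖m‖ ≤ R := by rw [hR]; gcongr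
        have e₂ : ε ^ 2 * (‖m‖ ^ 2 / 2 + 6 * k * ‖m‖) ≤ ε / 8 := by
          have := mul_le_mul_of_nonneg_left e₁ (sq_nonneg ε)
          nlinarith
        have e₃ : 0 ≤ B * (1 - ε / 4) ^ t := by positivity
        have e₄ := mul_le_mul_of_nonneg_right e₂ e₃
        rw [pow_succ (1 - ε / 4) t]
        linarith
      constructor
      · exact (norm_decoupled_step_le hε ha hb hκ hm hεm hεκ (hζs t (by omega)) (hηs t (by omega))
          h₃ h₄ h₁ hg₁ hg₂).trans (hfin _ (norm_nonneg _) hκD)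
      · exact (norm_decoupled_step_le hε hb ha hκ' hm hεm hεκ' (hηs t (by omega)) (hζs t (by omega))
          h₄ h₃ h₂ hg₂ hg₁).trans (hfin _ (norm_nonneg _) hκD')
  intro t ht
  obtain ⟨h₁, h₂⟩ := hsplit t _ (main t ht).1 (main t ht).2
  constructor
  · have e : (2 : ℂ) • X t = ζ t + η t := by simp only [hζ, hη]; module
    have := norm_add_le (ζ t) (η t)
    rw [← e, norm_smul] at this
    norm_num at this
    linarith
  · have e : (2 * Complex.I) • Y t = ζ t - η t := by simp only [hζ, hη]; module
    have := norm_sub_le (ζ t) (η t)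
    rw [← e, norm_smul] at this
    norm_num at this
    linarith

/-- The same for a damping operator `h⁻¹ L`, on the vectors killed by a product of factors
`L - μ` with `h ≤ Re μ`. -/
theorem exists_damped_network_bound {θ h : ℝ} (hθ : Real.sin θ ≠ 0) (hh : 0 < h) (L : E →L[ℂ] E)
    (l : List ℂ) (hl : ∀ μ ∈ l, h ≤ μ.re) :
    ∃ C ε₀ : ℝ, 0 ≤ C ∧ 0 < ε₀ ∧ ∀ ε : ℝ, 0 < ε → ε < ε₀ →
      ∀ (X Y F : ℕ → E) (T : ℕ) (B : ℝ),
      (∀ t < T, X (t + 1) = (Real.cos θ : ℂ) • X t + (Real.sin θ : ℂ) • Y t) →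
      (∀ t < T, Y (t + 1) = (-(Real.sin θ : ℂ) • X t + (Real.cos θ : ℂ) • Y t)
        - ((ε / h : ℝ) : ℂ) • L (-(Real.sin θ : ℂ) • X t + (Real.cos θ : ℂ) • Y t)
        + (ε : ℂ) • F t) →
      (∀ t ≤ T, l.foldl (fun v μ => L v - μ • v) (X t) = 0) →
      (∀ t ≤ T, l.foldl (fun v μ => L v - μ • v) (Y t) = 0) →
      ‖X 0‖ ≤ B → ‖Y 0‖ ≤ B → (∀ t < T, ‖F t‖ ≤ B * (1 - ε / 4) ^ t) →
      ∀ t ≤ T, ‖X t‖ ≤ C * B * (1 - ε / 4) ^ t ∧ ‖Y t‖ ≤ C * B * (1 - ε / 4) ^ t := by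
  induction l with
  | nil =>
    refine ⟨0, 1, le_rfl, one_pos, fun ε _ _ X Y F T B _ _ hX hY _ _ _ t ht => ?_⟩
    have h₁ := hX t ht
    have h₂ := hY t ht
    simp only [List.foldl_nil] at h₁ h₂
    simp [h₁, h₂]
  | cons μ l ih =>
    obtain ⟨C₁, ε₁, hC₁, hε₁, H₁⟩ := ih fun ν hν => hl ν (List.mem_cons_of_mem _ hν)
    have hμ : 1 ≤ (μ / (h : ℂ)).re := by
      have := hl μ List.mem_cons_self
      rw [Complex.div_ofReal_re, le_div_iff₀ hh]; linarith
    obtain ⟨C₂, ε₂, hC₂, hε₂, H₂⟩ := exists_damped_rotation_bound (E := E) hθ hμ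
    set N : E →L[ℂ] E := L - μ • ContinuousLinearMap.id ℂ E with hN
    have hNv : ∀ v, N v = L v - μ • v := fun v => by simp [hN]
    -- With `L = μ + N`, the sequences `N X`, `N Y` solve the same system with the shorter list,
    -- since `N` commutes with `L`. Then `X`, `Y` see scalar damping `μ / h` and the extra forcing
    -- from `N`. In `D`, the `1` covers the data and `F`, the last term covers the extra forcing,
    -- and `‖N‖` is slack.
    set D : ℝ := 1 + ‖N‖ + 2 * C₁ * ‖N‖ / h with hD
    have hD0 : 1 ≤ D := by
      have : 0 ≤ ‖N‖ + 2 * C₁ * ‖N‖ / h := by positivity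
      linarith
    refine ⟨C₂ * D, min (min ε₁ ε₂) 1, by positivity, by positivity, ?_⟩
    intro ε hε hlt X Y F T B hX hY hXl hYl hX0 hY0 hF
    obtain ⟨hlt, hε1⟩ := lt_min_iff.1 hlt
    obtain ⟨hlt₁, hlt₂⟩ := lt_min_iff.1 hlt
    have hγ : 0 < 1 - ε / 4 := by linarith
    have hB : 0 ≤ B := (norm_nonneg _).trans hX0
    have hcos : ‖(Real.cos θ : ℂ)‖ ≤ 1 := by
      rw [Complex.norm_real]; exact Real.abs_cos_le_one θ
    have hsin : ‖(-(Real.sin θ) : ℂ)‖ ≤ 1 := by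
      rw [norm_neg, Complex.norm_real]; exact Real.abs_sin_le_one θ
    have G₁ := H₁ ε hε hlt₁ (fun t => N (X t)) (fun t => N (Y t)) (fun t => N (F t)) T (‖N‖ * B)
      (fun t ht => by simp [hX t ht])
      (fun t ht => by
        have hcomm : ∀ v, N (L v) = L (N v) := fun v => by simp [hNv]
        simp only [hY t ht, map_add, map_sub, map_smul, hcomm])
      (fun t ht => by simpa [hNv] using hXl t ht)
      (fun t ht => by simpa [hNv] using hYl t ht)
      ((N.le_opNorm _).trans (by gcongr)) ((N.le_opNorm _).trans (by gcongr))
      (fun t ht => (N.le_opNorm _).trans (by rw [mul_assoc]; gcongr; exact hF t ht))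
    have G₂ := H₂ ε hε hlt₂ X Y (fun t => F t - ((1 / h : ℝ) : ℂ) •
        (-(Real.sin θ : ℂ) • N (X t) + (Real.cos θ : ℂ) • N (Y t))) T (D * B) hX
      (fun t ht => by
        have hhC : (h : ℂ) ≠ 0 := by exact_mod_cast hh.ne'
        rw [hY t ht]
        simp only [hNv, map_add, map_smul]
        push_cast
        match_scalars <;> field_simp <;> ring)
      (hX0.trans (le_mul_of_one_le_left hB hD0)) (hY0.trans (le_mul_of_one_le_left hB hD0))
      (fun t ht => by
        obtain ⟨g₁, g₂⟩ := G₁ t ht.le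
        refine (norm_sub_le _ _).trans ?_
        have hp := pow_pos hγ t
        have k : ‖-(Real.sin θ : ℂ) • N (X t) + (Real.cos θ : ℂ) • N (Y t)‖ ≤
            2 * (C₁ * (‖N‖ * B) * (1 - ε / 4) ^ t) := by
          refine (norm_add_le _ _).trans ?_
          rw [norm_smul, norm_smul]
          have k₁ := mul_le_mul hsin g₁ (norm_nonneg _) zero_le_one
          have k₂ := mul_le_mul hcos g₂ (norm_nonneg _) zero_le_one
          linarith
        rw [norm_smul, Complex.norm_real, Real.norm_of_nonneg (by positivity)]
        have k' : 1 / h * ‖-(Real.sin θ : ℂ) • N (X t) + (Real.cos θ : ℂ) • N (Y t)‖ ≤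
            1 / h * (2 * (C₁ * (‖N‖ * B) * (1 - ε / 4) ^ t)) := by gcongr
        have k₃ := hF t ht
        have k₄ : 0 ≤ ‖N‖ * (B * (1 - ε / 4) ^ t) := by positivity
        calc _ ≤ B * (1 - ε / 4) ^ t + 1 / h * (2 * (C₁ * (‖N‖ * B) * (1 - ε / 4) ^ t)) := by
                linarith
          _ ≤ B * (1 - ε / 4) ^ t + 1 / h * (2 * (C₁ * (‖N‖ * B) * (1 - ε / 4) ^ t))
              + ‖N‖ * (B * (1 - ε / 4) ^ t) := by linarith
          _ = D * B * (1 - ε / 4) ^ t := by rw [hD]; ring)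
    intro t ht
    have := G₂ t ht
    rwa [← mul_assoc] at this

end DampedRotation

/-! ### Kernel and annihilating products of the Laplacian -/

namespace WeightedDigraph

variable {V : Type*} [Fintype V] [DecidableEq V] (G : WeightedDigraph V)

theorem laplacian_mulVec (x : V → ℝ) (i : V) :
    G.laplacian.mulVec x i = ∑ v, G.weight i v * (x i - x v) := by
  rw [laplacian, Matrix.sub_mulVec, Pi.sub_apply, Matrix.mulVec_diagonal, Matrix.mulVec,
    dotProduct, Finset.sum_mul, ← Finset.sum_sub_distrib]
  exact Finset.sum_congr rfl fun v _ => by rw [Matrix.of_apply]; ring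

/-- Maximum principle: at a maximum the row of `L x` is a sum of nonnegative terms, so each
vanishes. Following a path backwards carries the maximum to the root. -/
theorem eq_of_edge_of_max {G : WeightedDigraph V} {x : V → ℝ} (hx : G.laplacian.mulVec x = 0)
    {v i : V} (he : G.Edge v i) (hi : ∀ u, x u ≤ x i) : x v = x i := by
  have h := congrFun hx i
  rw [laplacian_mulVec, Pi.zero_apply, Finset.sum_eq_zero_iff_of_nonneg fun u _ =>
    mul_nonneg (G.weight_nonneg i u) (sub_nonneg.2 (hi u))] at h
  rcases mul_eq_zero.1 (h v (Finset.mem_univ v)) with h | h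
  · exact absurd h (ne_of_gt he)
  · linarith

theorem root_eq_of_max {G : WeightedDigraph V} {x : V → ℝ} (hx : G.laplacian.mulVec x = 0)
    {r i : V} (hp : Relation.ReflTransGen G.Edge r i) (hi : ∀ u, x u ≤ x i) : x r = x i := by
  induction hp with
  | refl => rfl
  | tail _ he ih =>
    have h := eq_of_edge_of_max hx he hi
    exact (ih fun u => h ▸ hi u).trans h

/-- In the presence of a spanning tree the kernel of the Laplacian consists of the constants. -/
theorem eq_of_laplacian_mulVec_eq_zero {G : WeightedDigraph V} (hG : G.HasSpanningTree)
    {x : V → ℝ} (hx : G.laplacian.mulVec x = 0) (i j : V) : x i = x j := by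
  obtain ⟨r, hr⟩ := hG
  have hmax : ∀ y : V → ℝ, G.laplacian.mulVec y = 0 → ∀ u, y u ≤ y r := fun y hy u => by
    obtain ⟨k, -, hk⟩ := Finset.exists_max_image Finset.univ y ⟨r, Finset.mem_univ r⟩
    have hk' : ∀ u, y u ≤ y k := fun u => hk u (Finset.mem_univ u)
    rw [root_eq_of_max hy (hr k) hk']
    exact hk' u
  have h : ∀ u, x u = x r := fun u => by
    refine le_antisymm (hmax x hx u) ?_
    -- The root is also a minimum, as the kernel is invariant under negation.
    have := hmax (-x) (by rw [Matrix.mulVec_neg, hx, neg_zero]) u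
    simp only [Pi.neg_apply] at this
    linarith
  rw [h i, h j]

/-- The Laplacian as a complex operator. -/
noncomputable def complexLaplacian : (V → ℂ) →L[ℂ] (V → ℂ) :=
  LinearMap.toContinuousLinearMap (Matrix.toLin' (G.laplacian.map (fun a : ℝ => (a : ℂ))))

theorem complexLaplacian_apply (z : V → ℂ) :
    G.complexLaplacian z = (G.laplacian.map (fun a : ℝ => (a : ℂ))).mulVec z := by
  simp [complexLaplacian]

theorem complexLaplacian_ofReal (x : V → ℝ) :
    G.complexLaplacian (fun i => (x i : ℂ)) = fun i => ((G.laplacian.mulVec x i : ℝ) : ℂ) := by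
  rw [complexLaplacian_apply]
  ext i
  simp [Matrix.mulVec, dotProduct]

variable {G}

theorem eq_of_complexLaplacian_eq_zero (hG : G.HasSpanningTree) {z : V → ℂ}
    (hz : G.complexLaplacian z = 0) (i j : V) : z i = z j := by
  rw [complexLaplacian_apply] at hz
  apply Complex.ext
  · refine eq_of_laplacian_mulVec_eq_zero hG (x := fun i => (z i).re) (funext fun k => ?_) i j
    have := congrArg Complex.re (congrFun hz k)
    simpa [Matrix.mulVec, dotProduct] using this
  · refine eq_of_laplacian_mulVec_eq_zero hG (x := fun i => (z i).im) (funext fun k => ?_) i j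
    have := congrArg Complex.im (congrFun hz k)
    simpa [Matrix.mulVec, dotProduct] using this

theorem sum_mul_laplacian {w : V → ℝ} (hw : G.IsLeftNullVector w) (x : V → ℝ) :
    ∑ v, w v * G.laplacian.mulVec x v = 0 := by
  have := Matrix.dotProduct_mulVec w G.laplacian x
  rwa [hw.1, zero_dotProduct] at this

theorem sum_mul_complexLaplacian {w : V → ℝ} (hw : G.IsLeftNullVector w) (z : V → ℂ) :
    ∑ v, (w v : ℂ) * G.complexLaplacian z v = 0 := by
  have h := Matrix.dotProduct_mulVec (fun v => (w v : ℂ))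
    (G.laplacian.map (fun a : ℝ => (a : ℂ))) z
  have h₀ : Matrix.vecMul (fun v => (w v : ℂ)) (G.laplacian.map (fun a : ℝ => (a : ℂ))) = 0 := by
    ext i
    have := congrArg (fun a : ℝ => (a : ℂ)) (congrFun hw.1 i)
    simpa [Matrix.vecMul, dotProduct] using this
  rw [h₀, zero_dotProduct, ← complexLaplacian_apply] at h
  exact h

theorem eq_zero_of_complexLaplacian_eq_zero (hG : G.HasSpanningTree) {w : V → ℝ}
    (hw : G.IsLeftNullVector w) {z : V → ℂ} (hwz : ∑ v, (w v : ℂ) * z v = 0)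
    (hz : G.complexLaplacian z = 0) : z = 0 := by
  ext i
  have h : ∀ v, z v = z i := fun v => eq_of_complexLaplacian_eq_zero hG hz v i
  simp only [h, ← Finset.sum_mul] at hwz
  have h₁ : ∑ v, (w v : ℂ) = 1 := by exact_mod_cast hw.2
  simpa [h₁] using hwz

theorem complexLaplacian_foldl (l : List ℂ) (z : V → ℂ) :
    G.complexLaplacian (l.foldl (fun v μ => G.complexLaplacian v - μ • v) z) =
      l.foldl (fun v μ => G.complexLaplacian v - μ • v) (G.complexLaplacian z) := by
  induction l generalizing z with
  | nil => rfl
  | cons μ l ih => simp [ih]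

/-- On the vectors annihilated by `w`, zero roots can be dropped from an annihilating product. -/
theorem foldl_filter_eq_zero (hG : G.HasSpanningTree) {w : V → ℝ} (hw : G.IsLeftNullVector w)
    (l : List ℂ) {z : V → ℂ} (hwz : ∑ v, (w v : ℂ) * z v = 0)
    (hl : l.foldl (fun v μ => G.complexLaplacian v - μ • v) z = 0) :
    (l.filter (· ≠ 0)).foldl (fun v μ => G.complexLaplacian v - μ • v) z = 0 := by
  have hstep : ∀ (μ : ℂ) (z : V → ℂ), ∑ v, (w v : ℂ) * z v = 0 →
      ∑ v, (w v : ℂ) * (G.complexLaplacian z - μ • z) v = 0 := fun μ z hz => by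
    have : ∀ v, (w v : ℂ) * (G.complexLaplacian z - μ • z) v =
        (w v : ℂ) * G.complexLaplacian z v - μ * ((w v : ℂ) * z v) := fun v => by
      simp; ring
    simp only [this, Finset.sum_sub_distrib, ← Finset.mul_sum, hz, sum_mul_complexLaplacian hw]
    simp
  have hfold : ∀ (l : List ℂ) (z : V → ℂ), ∑ v, (w v : ℂ) * z v = 0 →
      ∑ v, (w v : ℂ) * (l.foldl (fun v μ => G.complexLaplacian v - μ • v) z) v = 0 := by
    intro l
    induction l with
    | nil => exact fun z hz => hz
    | cons μ l ih => exact fun z hz => ih _ (hstep μ z hz)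
  induction l generalizing z with
  | nil => exact hl
  | cons μ l ih =>
    have h := ih (hstep μ z hwz) hl
    by_cases hμ : μ = 0
    · subst hμ
      -- A factor with root `0` is `L` itself. Moved to the outside, it acts on a vector that is
      -- still annihilated by `w`, where `L` is injective.
      rw [zero_smul, sub_zero, ← complexLaplacian_foldl] at h
      simpa using eq_zero_of_complexLaplacian_eq_zero hG hw (hfold _ z hwz) h
    · simpa [hμ] using h

/-- Links the iterated factors to a polynomial in the matrix, so that Cayley-Hamilton applies. -/
theorem foldl_eq_aeval (l : List ℂ) (z : V → ℂ) :
    l.foldl (fun v μ => G.complexLaplacian v - μ • v) z =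
      (Polynomial.aeval (G.laplacian.map (fun a : ℝ => (a : ℂ)))
        (l.map fun μ => Polynomial.X - Polynomial.C μ).prod).mulVec z := by
  induction l generalizing z with
  | nil => simp
  | cons μ l ih =>
    rw [List.foldl_cons, ih, List.map_cons, List.prod_cons, mul_comm, map_mul,
      ← Matrix.mulVec_mulVec]
    congr 1
    simp [complexLaplacian_apply, Matrix.sub_mulVec, Matrix.algebraMap_eq_diagonal,
      Matrix.mulVec_diagonal, funext_iff]

/-- The disagreement vectors are killed by a product of factors `L - μ` over nonzero eigenvalues. -/
theorem exists_annihilating_eigenvalues (hG : G.HasSpanningTree) {w : V → ℝ}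
    (hw : G.IsLeftNullVector w) :
    ∃ l : List ℂ, (∀ μ ∈ l, μ ∈ spectrum ℂ (G.laplacian.map (fun a : ℝ => (a : ℂ))) ∧ μ ≠ 0) ∧
      ∀ z : V → ℂ, ∑ v, (w v : ℂ) * z v = 0 →
        l.foldl (fun v μ => G.complexLaplacian v - μ • v) z = 0 := by
  set A : Matrix V V ℂ := G.laplacian.map (fun a : ℝ => (a : ℂ)) with hA
  refine ⟨A.charpoly.roots.toList.filter (· ≠ 0), fun μ hμ => ?_, fun z hz => ?_⟩
  · obtain ⟨h₁, h₂⟩ := List.mem_filter.1 hμ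
    refine ⟨?_, by simpa using h₂⟩
    rw [Matrix.mem_spectrum_iff_isRoot_charpoly]
    exact (Polynomial.mem_roots'.1 (Multiset.mem_toList.1 h₁)).2
  · refine foldl_filter_eq_zero hG hw _ hz ?_
    have hprod : (A.charpoly.roots.toList.map fun μ => Polynomial.X - Polynomial.C μ).prod
        = A.charpoly := by
      have h := (IsAlgClosed.splits A.charpoly).eq_prod_roots_of_monic A.charpoly_monic
      conv_rhs => rw [h]
      rw [← Multiset.prod_coe, ← Multiset.map_coe, Multiset.coe_toList]
    rw [foldl_eq_aeval, hprod, ← hA, Matrix.aeval_self_charpoly, Matrix.zero_mulVec]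

end WeightedDigraph

/-! ### Decay of real disagreement vectors -/

section RealBounds

variable {V : Type*} [Fintype V] [DecidableEq V]

theorem WeightedDigraph.exists_laplacian_bound (G : WeightedDigraph V) :
    ∃ Λ : ℝ, 0 ≤ Λ ∧ ∀ (x : V → ℝ) (r : ℝ), (∀ v, |x v| ≤ r) →
      ∀ i, |G.laplacian.mulVec x i| ≤ Λ * r := by
  refine ⟨‖G.complexLaplacian‖, norm_nonneg _, fun x r hx i => ?_⟩
  have hr : 0 ≤ r := (abs_nonneg _).trans (hx i)
  have h₁ : ‖(fun v => (x v : ℂ))‖ ≤ r := (pi_norm_le_iff_of_nonneg hr).2 fun v => by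
    rw [Complex.norm_real]; exact hx v
  have h₂ := (norm_le_pi_norm _ i).trans
    ((G.complexLaplacian.le_opNorm _).trans (mul_le_mul_of_nonneg_left h₁ (norm_nonneg _)))
  rwa [G.complexLaplacian_ofReal, Complex.norm_real] at h₂

/-- Disagreements of rotating agents which are coupled with a small gain decay at the rate of the
forcing, with a constant independent of the gain. -/
theorem exists_disagreement_bound {G : WeightedDigraph V} (hG : G.HasSpanningTree)
    {θ : ℝ} (hθ : Real.sin θ ≠ 0) {h : ℝ} (hpos : 0 < h)
    (hle : ∀ μ ∈ spectrum ℂ (G.laplacian.map (fun a : ℝ => (a : ℂ))), μ ≠ 0 → h ≤ μ.re)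
    {w : V → ℝ} (hw : G.IsLeftNullVector w) :
    ∃ C ε₀ : ℝ, 0 ≤ C ∧ 0 < ε₀ ∧ ∀ ε : ℝ, 0 < ε → ε < ε₀ →
      ∀ (X Y F : ℕ → V → ℝ) (T : ℕ) (B : ℝ),
      (∀ t < T, ∀ i, X (t + 1) i = Real.cos θ * X t i + Real.sin θ * Y t i) →
      (∀ t < T, ∀ i, Y (t + 1) i = (-Real.sin θ * X t i + Real.cos θ * Y t i)
        - ε / h * G.laplacian.mulVec (fun v => -Real.sin θ * X t v + Real.cos θ * Y t v) i
        + ε * F t i) →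
      (∀ t ≤ T, ∑ v, w v * X t v = 0) → (∀ t ≤ T, ∑ v, w v * Y t v = 0) →
      (∀ i, |X 0 i| ≤ B) → (∀ i, |Y 0 i| ≤ B) →
      (∀ t < T, ∀ i, |F t i| ≤ B * (1 - ε / 4) ^ t) →
      ∀ t ≤ T, ∀ i, |X t i| ≤ C * B * (1 - ε / 4) ^ t ∧ |Y t i| ≤ C * B * (1 - ε / 4) ^ t := by
  obtain ⟨l, hl, hl₀⟩ := WeightedDigraph.exists_annihilating_eigenvalues hG hw
  obtain ⟨C, ε₀, hC, hε₀, H⟩ := exists_damped_network_bound hθ hpos G.complexLaplacian l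
    fun μ hμ => hle μ (hl μ hμ).1 (hl μ hμ).2
  refine ⟨C, min ε₀ 4, hC, by positivity, ?_⟩
  intro ε hε hlt X Y F T B hX hY hXw hYw hX0 hY0 hF t ht i
  have hγ : 0 < 1 - ε / 4 := by linarith [(lt_min_iff.1 hlt).2]
  have hB : 0 ≤ B := (abs_nonneg _).trans (hX0 i)
  have hnorm : ∀ (x : V → ℝ) (r : ℝ), 0 ≤ r → (∀ v, |x v| ≤ r) → ‖(fun v => (x v : ℂ))‖ ≤ r :=
    fun x r hr hx => (pi_norm_le_iff_of_nonneg hr).2 fun v => by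
      rw [Complex.norm_real]; exact hx v
  have hnorm' : ∀ (x : V → ℝ) (r : ℝ), ‖(fun v => (x v : ℂ))‖ ≤ r → |x i| ≤ r :=
    fun x r hr => by
      have := (norm_le_pi_norm _ i).trans hr
      rwa [Complex.norm_real] at this
  have key := H ε hε (lt_min_iff.1 hlt).1 (fun t v => (X t v : ℂ)) (fun t v => (Y t v : ℂ))
    (fun t v => (F t v : ℂ)) T B
    (fun t ht => by
      ext v
      simp only [hX t ht v, Pi.add_apply, Pi.smul_apply, smul_eq_mul]
      push_cast; ring)
    (fun t ht => by
      have e : (-(Real.sin θ : ℂ) • (fun v => (X t v : ℂ)) + (Real.cos θ : ℂ) •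
          (fun v => (Y t v : ℂ))) =
          fun v => ((-Real.sin θ * X t v + Real.cos θ * Y t v : ℝ) : ℂ) := by
        ext v
        simp only [Pi.add_apply, Pi.smul_apply, smul_eq_mul]
        push_cast; ring
      rw [e, G.complexLaplacian_ofReal]
      ext v
      simp only [hY t ht v, Pi.add_apply, Pi.sub_apply, Pi.smul_apply, smul_eq_mul]
      push_cast; ring)
    (fun t ht => hl₀ _ (by exact_mod_cast hXw t ht))
    (fun t ht => hl₀ _ (by exact_mod_cast hYw t ht))
    (hnorm _ _ hB hX0) (hnorm _ _ hB hY0)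
    (fun t ht => hnorm _ _ (by positivity) (hF t ht)) t ht
  exact ⟨hnorm' _ _ key.1, hnorm' _ _ key.2⟩

end RealBounds

/-! ### Error and innovation identities of the closed loop -/

section ClosedLoop

variable {V : Type*} [Fintype V] (G : WeightedDigraph V) (P : Params) (x₀ : V → Fin 2 → ℝ)

/-- Encoder and decoder run the same recursion on the same signals from the same start. -/
theorem dec_eq_est (t : ℕ) (i v : V) :
    (closedLoop G P x₀ t).dec i v = (closedLoop G P x₀ t).est i := by
  induction t with
  | zero => rfl
  | succ t ih =>
    change P.update t ((closedLoop G P x₀ t).dec i v) _ =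
      P.update t ((closedLoop G P x₀ t).est i) _
    rw [ih]

theorem plant_succ_zero (t : ℕ) (i : V) :
    (closedLoop G P x₀ (t + 1)).plant i 0 = Real.cos P.θ * (closedLoop G P x₀ t).plant i 0
      + Real.sin P.θ * (closedLoop G P x₀ t).plant i 1 := by
  change nextPlant G P t _ i 0 = _
  simp [nextPlant, stateMatrix, inputVector, dotProduct, Fin.sum_univ_two]

theorem plant_succ_one (t : ℕ) (i : V) :
    (closedLoop G P x₀ (t + 1)).plant i 1 = -Real.sin P.θ * (closedLoop G P x₀ t).plant i 0
      + Real.cos P.θ * (closedLoop G P x₀ t).plant i 1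
      + control G P t (closedLoop G P x₀ t) i := by
  change nextPlant G P t _ i 1 = _
  simp [nextPlant, stateMatrix, inputVector, dotProduct, Fin.sum_univ_two]

theorem est_succ_one {t : ℕ} (ht : 1 ≤ t) (i : V) :
    (closedLoop G P x₀ (t + 1)).est i 1 =
      Real.cos P.θ / Real.sin P.θ * (closedLoop G P x₀ (t + 1)).est i 0
        - (closedLoop G P x₀ t).est i 0 / Real.sin P.θ := by
  have h : ¬ t + 1 < 2 := by omega
  change P.update t ((closedLoop G P x₀ t).est i) _ 1 =
    Real.cos P.θ / Real.sin P.θ * P.update t ((closedLoop G P x₀ t).est i) _ 0 - _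
  simp [Params.update, h]

variable {G P x₀}

/-- Without saturation the output is estimated with error at most half the scale. -/
theorem abs_sub_est_le {t : ℕ} (hp : 0 < P.scale t) {i : V}
    (hsat : |(closedLoop G P x₀ (t + 1)).plant i 0 - P.predict t ((closedLoop G P x₀ t).est i)| ≤
      ((P.M (t + 1) : ℝ) + 1 / 2) * P.scale t) :
    |(closedLoop G P x₀ (t + 1)).plant i 0 - (closedLoop G P x₀ (t + 1)).est i 0| ≤
      1 / 2 * P.scale t := by
  set y := (closedLoop G P x₀ (t + 1)).plant i 0 with hy
  set π := P.predict t ((closedLoop G P x₀ t).est i) with hπ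
  have he : (closedLoop G P x₀ (t + 1)).est i 0 =
      π + P.scale t * (quantizer (P.M (t + 1)) ((y - π) / P.scale t) : ℝ) := by
    change P.update t ((closedLoop G P x₀ t).est i) (nextSignal G P t (closedLoop G P x₀ t) i) 0 = _
    simp only [Params.update, Matrix.cons_val_zero]
    rfl
  have hq := abs_sub_quantizer_le (M := P.M (t + 1)) (y := (y - π) / P.scale t) (by
    rwa [abs_div, abs_of_pos hp, div_le_iff₀ hp])
  have hfac : y - (closedLoop G P x₀ (t + 1)).est i 0 = ((y - π) / P.scale t
      - (quantizer (P.M (t + 1)) ((y - π) / P.scale t) : ℝ)) * P.scale t := by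
    rw [he]; field_simp; ring
  rw [hfac, abs_mul, abs_of_pos hp]
  gcongr

/-- Inverting the rotation gives `x₂(t+1) = cot θ x₁(t+1) - csc θ x₁(t) + u(t)`. The estimate omits
the control, which therefore appears as an error. -/
theorem error_one_eq (hθ : Real.sin P.θ ≠ 0) {t : ℕ} (ht : 1 ≤ t) (i : V) :
    (closedLoop G P x₀ (t + 1)).plant i 1 - (closedLoop G P x₀ (t + 1)).est i 1 =
      Real.cos P.θ / Real.sin P.θ *
        ((closedLoop G P x₀ (t + 1)).plant i 0 - (closedLoop G P x₀ (t + 1)).est i 0)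
      - ((closedLoop G P x₀ t).plant i 0 - (closedLoop G P x₀ t).est i 0) / Real.sin P.θ
      + control G P t (closedLoop G P x₀ t) i := by
  rw [est_succ_one G P x₀ ht, plant_succ_one, plant_succ_zero]
  have := Real.sin_sq_add_cos_sq P.θ
  field_simp
  linear_combination (-(closedLoop G P x₀ t).plant i 0) * this

theorem innovation_eq (hθ : Real.sin P.θ ≠ 0) {t : ℕ} (ht : 1 ≤ t) (i : V) :
    (closedLoop G P x₀ (t + 2)).plant i 0
        - P.predict (t + 1) ((closedLoop G P x₀ (t + 1)).est i) =
      2 * Real.cos P.θ *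
        ((closedLoop G P x₀ (t + 1)).plant i 0 - (closedLoop G P x₀ (t + 1)).est i 0)
      - ((closedLoop G P x₀ t).plant i 0 - (closedLoop G P x₀ t).est i 0)
      + Real.sin P.θ * control G P t (closedLoop G P x₀ t) i := by
  have h : ¬ t + 1 + 1 ≤ 2 := by omega
  have he := error_one_eq (G := G) (x₀ := x₀) hθ ht i
  field_simp at he
  rw [plant_succ_zero, Params.predict, if_neg h]
  linear_combination he

theorem control_of_le_one {t : ℕ} (ht : t ≤ 1) (S : NetworkState V) (i : V) :
    control G P t S i = 0 := if_pos ht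

/-- The gains are `ε / h` times the second row of the rotation, so the control damps the rotated
second coordinate through `L`. -/
theorem control_smallGain [DecidableEq V] {θ h ε p₀ : ℝ} {M : ℕ → ℕ} {t : ℕ} (ht : 2 ≤ t) (i : V) :
    control G (smallGainParams θ h ε p₀ M) t
        (closedLoop G (smallGainParams θ h ε p₀ M) x₀ t) i =
      -(ε / h * G.laplacian.mulVec (fun v =>
        -Real.sin θ * (closedLoop G (smallGainParams θ h ε p₀ M) x₀ t).est v 0
          + Real.cos θ * (closedLoop G (smallGainParams θ h ε p₀ M) x₀ t).est v 1) i) := by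
  rw [control, if_neg (by omega), G.laplacian_mulVec, Fin.sum_univ_two]
  simp only [dec_eq_est]
  simp only [smallGainParams, Matrix.cons_val_zero, Matrix.cons_val_one, Finset.mul_sum,
    ← Finset.sum_add_distrib, ← Finset.sum_neg_distrib]
  exact Finset.sum_congr rfl fun v _ => by ring

end ClosedLoop

/-! ### Bootstrap between disagreements and quantization errors -/

section Consensus

variable {V : Type*} [Fintype V]

/-- The disagreement of agent `i` in coordinate `j`. -/
def disagreement (w : V → ℝ) (x : V → Fin 2 → ℝ) (j : Fin 2) (i : V) : ℝ :=
  x i j - ∑ v, w v * x v j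

theorem sum_mul_disagreement {w : V → ℝ} (hw : ∑ v, w v = 1) (x : V → Fin 2 → ℝ) (j : Fin 2) :
    ∑ v, w v * disagreement w x j v = 0 := by
  simp only [disagreement, mul_sub, Finset.sum_sub_distrib, ← Finset.sum_mul, hw, one_mul, sub_self]

theorem abs_cos_mul_add_sin_mul_le (θ : ℝ) {a b r s : ℝ} (ha : |a| ≤ r) (hb : |b| ≤ s) :
    |Real.cos θ * a + Real.sin θ * b| ≤ r + s := by
  refine (abs_add_le _ _).trans ?_
  rw [abs_mul, abs_mul]
  have h₁ := mul_le_mul (Real.abs_cos_le_one θ) ha (abs_nonneg _) zero_le_one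
  have h₂ := mul_le_mul (Real.abs_sin_le_one θ) hb (abs_nonneg _) zero_le_one
  linarith

theorem abs_neg_sin_mul_add_cos_mul_le (θ : ℝ) {a b r s : ℝ} (ha : |a| ≤ r) (hb : |b| ≤ s) :
    |-Real.sin θ * a + Real.cos θ * b| ≤ r + s := by
  have h := abs_cos_mul_add_sin_mul_le θ hb (b := -a) (s := r) (by rwa [abs_neg])
  rw [add_comm r s]
  convert h using 2
  ring

variable (G : WeightedDigraph V) (P : Params) (x₀ : V → Fin 2 → ℝ) (w : V → ℝ)

theorem disagreement_succ_zero (t : ℕ) (i : V) :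
    disagreement w (closedLoop G P x₀ (t + 1)).plant 0 i =
      Real.cos P.θ * disagreement w (closedLoop G P x₀ t).plant 0 i
        + Real.sin P.θ * disagreement w (closedLoop G P x₀ t).plant 1 i := by
  have h : ∑ v, w v * (closedLoop G P x₀ (t + 1)).plant v 0 =
      Real.cos P.θ * ∑ v, w v * (closedLoop G P x₀ t).plant v 0
        + Real.sin P.θ * ∑ v, w v * (closedLoop G P x₀ t).plant v 1 := by
    rw [Finset.mul_sum, Finset.mul_sum, ← Finset.sum_add_distrib]
    exact Finset.sum_congr rfl fun v _ => by rw [plant_succ_zero]; ring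
  rw [disagreement, h, plant_succ_zero, disagreement, disagreement]
  ring

theorem disagreement_succ_one (t : ℕ) (i : V) :
    disagreement w (closedLoop G P x₀ (t + 1)).plant 1 i =
      -Real.sin P.θ * disagreement w (closedLoop G P x₀ t).plant 0 i
        + Real.cos P.θ * disagreement w (closedLoop G P x₀ t).plant 1 i
        + (control G P t (closedLoop G P x₀ t) i
          - ∑ v, w v * control G P t (closedLoop G P x₀ t) v) := by
  have h : ∑ v, w v * (closedLoop G P x₀ (t + 1)).plant v 1 =
      -Real.sin P.θ * ∑ v, w v * (closedLoop G P x₀ t).plant v 0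
        + Real.cos P.θ * ∑ v, w v * (closedLoop G P x₀ t).plant v 1
        + ∑ v, w v * control G P t (closedLoop G P x₀ t) v := by
    rw [Finset.mul_sum, Finset.mul_sum, ← Finset.sum_add_distrib, ← Finset.sum_add_distrib]
    exact Finset.sum_congr rfl fun v _ => by rw [plant_succ_one]; ring
  rw [disagreement, h, plant_succ_one, disagreement, disagreement]
  ring

variable {G x₀ w}

/-- The control in terms of disagreements and estimation errors. -/
theorem control_eq_disagreement [DecidableEq V] {θ h ε p₀ : ℝ} {M : ℕ → ℕ} {t : ℕ} (ht : 2 ≤ t)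
    (i : V) :
    control G (smallGainParams θ h ε p₀ M) t
        (closedLoop G (smallGainParams θ h ε p₀ M) x₀ t) i =
      -(ε / h * G.laplacian.mulVec (fun v =>
        -Real.sin θ *
            disagreement w (closedLoop G (smallGainParams θ h ε p₀ M) x₀ t).plant 0 v
          + Real.cos θ *
            disagreement w (closedLoop G (smallGainParams θ h ε p₀ M) x₀ t).plant 1 v) i)
      + ε * (1 / h * G.laplacian.mulVec (fun v =>
        -Real.sin θ * ((closedLoop G (smallGainParams θ h ε p₀ M) x₀ t).plant v 0
            - (closedLoop G (smallGainParams θ h ε p₀ M) x₀ t).est v 0)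
          + Real.cos θ * ((closedLoop G (smallGainParams θ h ε p₀ M) x₀ t).plant v 1
            - (closedLoop G (smallGainParams θ h ε p₀ M) x₀ t).est v 1)) i) := by
  rw [control_smallGain ht]
  simp only [G.laplacian_mulVec, disagreement, Finset.mul_sum, ← Finset.sum_neg_distrib,
    ← Finset.sum_add_distrib]
  exact Finset.sum_congr rfl fun v _ => by ring

/-- The control lies in the range of `L`, which `w` annihilates; the weighted average thus rotates
freely and drops out of the disagreement dynamics. -/
theorem sum_mul_control [DecidableEq V] (hw : G.IsLeftNullVector w) {θ h ε p₀ : ℝ} {M : ℕ → ℕ}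
    (t : ℕ) :
    ∑ v, w v * control G (smallGainParams θ h ε p₀ M) t
      (closedLoop G (smallGainParams θ h ε p₀ M) x₀ t) v = 0 := by
  rcases Nat.lt_or_ge t 2 with ht | ht
  · exact Finset.sum_eq_zero fun v _ => by rw [control_of_le_one (by omega), mul_zero]
  · simp only [control_smallGain ht, mul_neg, mul_left_comm _ (ε / h), Finset.sum_neg_distrib,
      ← Finset.mul_sum]
    rw [WeightedDigraph.sum_mul_laplacian hw, mul_zero, neg_zero]

/-- The innovation stays below the saturation level if the previous errors and the control are
small compared to the scale. -/
theorem abs_innovation_le (θ : ℝ) {γ p a b u : ℝ} (hp : 0 ≤ p) (hγ : 15 / 16 ≤ γ) (hγ1 : γ ≤ 1)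
    (ha : |a| ≤ 1 / 2 * (γ * p)) (hb : |b| ≤ 1 / 2 * p) (hu : |u| ≤ 1 / 8 * (γ * p)) :
    |2 * Real.cos θ * a - b + Real.sin θ * u| ≤ (|Real.cos θ| + 1) * (γ * γ * p) := by
  have k₁ : |2 * Real.cos θ * a| ≤ |Real.cos θ| * (γ * p) := by
    rw [abs_mul, abs_mul, abs_two]
    have := mul_le_mul_of_nonneg_left ha (abs_nonneg (Real.cos θ))
    linarith
  have k₂ : |Real.sin θ * u| ≤ 1 / 8 * (γ * p) := by
    rw [abs_mul]
    have := mul_le_mul (Real.abs_sin_le_one θ) hu (abs_nonneg _) zero_le_one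
    linarith
  have k₃ := abs_add_le (2 * Real.cos θ * a - b) (Real.sin θ * u)
  have k₄ := abs_sub (2 * Real.cos θ * a) b
  -- For `γ ≥ 15/16`, shrinking the cosine term costs at most `1/16`, and `γ/8 + 1/2 + 1/16 ≤ γ ^
  -- 2`.
  have hcoef : |Real.cos θ| * γ + 1 / 8 * γ + 1 / 2 ≤ (|Real.cos θ| + 1) * (γ * γ) := by
    have : |Real.cos θ| * (γ * (1 - γ)) ≤ 1 * (1 / 16) :=
      mul_le_mul (Real.abs_cos_le_one θ) (by nlinarith) (by nlinarith) zero_le_one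
    nlinarith
  have := mul_le_mul_of_nonneg_right hcoef hp
  linarith

/-- The error of the second coordinate in terms of the errors of the first one. -/
theorem abs_error_one_le (θ : ℝ) {p q a b u : ℝ} (hqp : q ≤ p) (ha : |a| ≤ 1 / 2 * q)
    (hb : |b| ≤ 1 / 2 * p) (hu : |u| ≤ 1 / 8 * q) :
    |Real.cos θ / Real.sin θ * a - b / Real.sin θ + u| ≤ (|1 / Real.sin θ| + 2) * p := by
  have hp : 0 ≤ p := by linarith [(abs_nonneg b).trans hb]
  have k₁ : |Real.cos θ / Real.sin θ * a| ≤ |1 / Real.sin θ| * (1 / 2 * p) := by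
    have : Real.cos θ / Real.sin θ * a = 1 / Real.sin θ * (Real.cos θ * a) := by ring
    rw [this, abs_mul]
    refine mul_le_mul_of_nonneg_left ?_ (abs_nonneg _)
    rw [abs_mul]
    have := mul_le_mul (Real.abs_cos_le_one θ) ha (abs_nonneg _) zero_le_one
    linarith
  have k₂ : |b / Real.sin θ| ≤ |1 / Real.sin θ| * (1 / 2 * p) := by
    rw [div_eq_mul_one_div, mul_comm, abs_mul]
    exact mul_le_mul_of_nonneg_left hb (abs_nonneg _)
  have k₃ := abs_add_le (Real.cos θ / Real.sin θ * a - b / Real.sin θ) u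
  have k₄ := abs_sub (Real.cos θ / Real.sin θ * a) (b / Real.sin θ)
  linarith

set_option maxHeartbeats 400000 in
/-- The interplay of disagreements `d`, estimation errors `e` and controls `u`: if an estimate is
accurate whenever its innovation is below the saturation level, then for small gains no saturation
occurs, and disagreements decay at the rate of the scale with a constant independent of the
gain. -/
theorem exists_disagreement_bound_of_unsaturated [DecidableEq V] (hG : G.HasSpanningTree)
    {θ : ℝ} (hθ : Real.sin θ ≠ 0) {h : ℝ} (hpos : 0 < h)
    (hle : ∀ μ ∈ spectrum ℂ (G.laplacian.map (fun a : ℝ => (a : ℂ))), μ ≠ 0 → h ≤ μ.re)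
    (hw : G.IsLeftNullVector w) :
    ∃ R ε₀ : ℝ, 0 < ε₀ ∧ ε₀ ≤ 1 / 4 ∧ ∀ ε : ℝ, 0 < ε → ε < ε₀ →
      ∀ (p₀ : ℝ) (d e : ℕ → Fin 2 → V → ℝ) (u : ℕ → V → ℝ), 0 < p₀ →
        (∀ t j, ∑ v, w v * d t j v = 0) →
        (∀ t i, d (t + 1) 0 i = Real.cos θ * d t 0 i + Real.sin θ * d t 1 i) →
        (∀ t i, d (t + 1) 1 i = -Real.sin θ * d t 0 i + Real.cos θ * d t 1 i + u t i) →
        (∀ t ≤ 1, ∀ i, u t i = 0) →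
        (∀ t, 2 ≤ t → ∀ i, u t i =
          -(ε / h * G.laplacian.mulVec (fun v =>
            -Real.sin θ * d t 0 v + Real.cos θ * d t 1 v) i)
          + ε * (1 / h * G.laplacian.mulVec (fun v =>
            -Real.sin θ * e t 0 v + Real.cos θ * e t 1 v) i)) →
        (∀ t, 1 ≤ t → ∀ i, e (t + 1) 1 i =
          Real.cos θ / Real.sin θ * e (t + 1) 0 i - e t 0 i / Real.sin θ + u t i) →
        (∀ n i, |2 * Real.cos θ * e (n + 2) 0 i - e (n + 1) 0 i + Real.sin θ * u (n + 1) i| ≤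
            (|Real.cos θ| + 1) * (p₀ * (1 - ε / 4) ^ (n + 2)) →
          |e (n + 3) 0 i| ≤ 1 / 2 * (p₀ * (1 - ε / 4) ^ (n + 2))) →
        (∀ i j, |d 0 j i| ≤ p₀) →
        (∀ i, |e 1 0 i| ≤ 1 / 2 * (p₀ * (1 - ε / 4) ^ 0)) →
        (∀ i, |e 2 0 i| ≤ 1 / 2 * (p₀ * (1 - ε / 4) ^ 1)) →
        ∀ t i j, |d t j i| ≤ R * p₀ * (1 - ε / 4) ^ t := by
  obtain ⟨C, ε₁, hC, hε₁, H⟩ := exists_disagreement_bound hG hθ hpos hle hw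
  obtain ⟨Λ, hΛ, HΛ⟩ := G.exists_laplacian_bound
  set σ : ℝ := |1 / Real.sin θ| with hσ
  have hσ0 : 0 ≤ σ := abs_nonneg _
  set D : ℝ := σ + 2 with hD
  -- The `4` bounds the disagreements at time `2`, after two uncontrolled steps that at most double
  -- them; the rest bounds the forcing by errors.
  set B₀ : ℝ := 4 + 1 / h * (Λ * (2 * D)) with hB₀
  have hB₀0 : 4 ≤ B₀ := by
    have : 0 ≤ 1 / h * (Λ * (2 * D)) := by positivity
    linarith
  -- The control will be at most `ε Q` times the scale two steps earlier. The threshold makes `ε Q ≤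
  -- 1/16`, and `γ ^ 2 ≥ 1/2` turns this into `1/8` of the current scale.
  set Q : ℝ := 1 / h * (Λ * (2 * (C * B₀) + 2 * D)) with hQ
  have hQ0 : 0 ≤ Q := by positivity
  refine ⟨2 * (C * B₀ + 4), min (min ε₁ (1 / 4)) (1 / (16 * Q + 1)), by positivity,
    (min_le_left _ _).trans (min_le_right _ _), ?_⟩
  intro ε hε hlt p₀ d e u hp₀ hdw hdX hdY hu1 hu2 he1 hq hd₀ he0_one he0_two
  obtain ⟨hlt, hεQ⟩ := lt_min_iff.1 hlt
  obtain ⟨hlt, hε4⟩ := lt_min_iff.1 hlt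
  rw [lt_div_iff₀ (by positivity)] at hεQ
  have hεQ' : ε * Q ≤ 1 / 16 := by linarith
  set γ : ℝ := 1 - ε / 4 with hγ
  have hγ1 : γ ≤ 1 := by linarith
  have hγ15 : 15 / 16 ≤ γ := by linarith
  have hγ0 : 0 < γ := by linarith
  have hp : ∀ t, 0 < p₀ * γ ^ t := fun t => by positivity
  have hps : ∀ t, p₀ * γ ^ (t + 1) ≤ p₀ * γ ^ t := fun t =>
    mul_le_mul_of_nonneg_left (pow_le_pow_of_le_one hγ0.le hγ1 (Nat.le_succ t)) hp₀.le
  let F : ℕ → V → ℝ := fun t i => 1 / h * G.laplacian.mulVec (fun v =>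
    -Real.sin θ * e t 0 v + Real.cos θ * e t 1 v) i
  replace hu2 : ∀ t, 2 ≤ t → ∀ i, u t i = -(ε / h * G.laplacian.mulVec (fun v =>
      -Real.sin θ * d t 0 v + Real.cos θ * d t 1 v) i) + ε * F t i := hu2
  -- the disagreements before the control starts
  have hd1 : ∀ i j, |d 1 j i| ≤ 2 * p₀ := fun i j => by
    have h₀ := hd₀ i 0
    have h₁ := hd₀ i 1
    fin_cases j
    · have := abs_cos_mul_add_sin_mul_le θ h₀ h₁
      rw [← two_mul] at this
      simpa [hdX 0 i] using this
    · have := abs_neg_sin_mul_add_cos_mul_le θ h₀ h₁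
      rw [← two_mul] at this
      simpa [hdY 0 i, hu1 0 (by norm_num) i] using this
  have hd2 : ∀ i j, |d 2 j i| ≤ 4 * p₀ := fun i j => by
    have h₀ := hd1 i 0
    have h₁ := hd1 i 1
    have e4 : 2 * p₀ + 2 * p₀ = 4 * p₀ := by ring
    fin_cases j
    · have := abs_cos_mul_add_sin_mul_le θ h₀ h₁
      rw [e4] at this
      simpa [hdX 1 i] using this
    · have := abs_neg_sin_mul_add_cos_mul_le θ h₀ h₁
      rw [e4] at this
      simpa [hdY 1 i, hu1 1 le_rfl i] using this
  -- errors of both coordinates from errors of the first one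
  have herr : ∀ n, (∀ i, |e (n + 1) 0 i| ≤ 1 / 2 * (p₀ * γ ^ n)) →
      (∀ i, |e (n + 2) 0 i| ≤ 1 / 2 * (p₀ * γ ^ (n + 1))) →
      (∀ i, |u (n + 1) i| ≤ 1 / 8 * (p₀ * γ ^ (n + 1))) →
      ∀ i j, |e (n + 2) j i| ≤ D * (p₀ * γ ^ n) := by
    intro n h₁ h₂ h₃ i j
    have hpn := hps n
    have hp0 := hp n
    fin_cases j
    · have := h₂ i
      change |e (n + 2) 0 i| ≤ _
      nlinarith [mul_nonneg hσ0 hp0.le]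
    · change |e (n + 2) 1 i| ≤ _
      rw [he1 (n + 1) (by omega) i]
      exact abs_error_one_le θ hpn (h₂ i) (h₁ i) (h₃ i)
  have hFbound : ∀ n, (∀ i j, |e (n + 2) j i| ≤ D * (p₀ * γ ^ n)) →
      ∀ i, |F (n + 2) i| ≤ 1 / h * (Λ * (2 * D)) * (p₀ * γ ^ n) := by
    intro n h₁ i
    have k := HΛ _ _ (fun v => abs_neg_sin_mul_add_cos_mul_le θ (h₁ v 0) (h₁ v 1)) i
    change |1 / h * _| ≤ _
    rw [abs_mul, abs_of_pos (by positivity : 0 < 1 / h)]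
    calc _ ≤ 1 / h * (Λ * (D * (p₀ * γ ^ n) + D * (p₀ * γ ^ n))) :=
          mul_le_mul_of_nonneg_left k (by positivity)
      _ = _ := by ring
  clear_value F
  -- disagreements from errors
  have hdis : ∀ n, (∀ m < n, ∀ i j, |e (m + 2) j i| ≤ D * (p₀ * γ ^ m)) →
      ∀ i j, |d (n + 2) j i| ≤ C * (B₀ * p₀) * γ ^ n := by
    intro n h₁ i j
    have h4 : 4 * p₀ ≤ B₀ * p₀ := mul_le_mul_of_nonneg_right hB₀0 hp₀.le
    -- Time is shifted by `2`, when the control starts. The finite horizon `n` means that only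
    -- errors before time `n + 2` are used, which keeps the bootstrap from being circular.
    have key := H ε hε hlt (fun n => d (n + 2) 0) (fun n => d (n + 2) 1) (fun n => F (n + 2)) n
      (B₀ * p₀) (fun t _ i => hdX (t + 2) i)
      (fun t _ i => by
        have k₁ := hdY (t + 2) i
        rw [hu2 (t + 2) (by omega) i] at k₁
        change d (t + 2 + 1) 1 i = _
        rw [k₁]
        ring)
      (fun t _ => hdw (t + 2) 0) (fun t _ => hdw (t + 2) 1)
      (fun i => (hd2 i 0).trans h4) (fun i => (hd2 i 1).trans h4)
      (fun m hm i => (hFbound m (h₁ m hm) i).trans (by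
        have := (hp m).le
        calc _ ≤ B₀ * (p₀ * γ ^ m) := mul_le_mul_of_nonneg_right (by linarith) this
          _ = _ := by ring)) n le_rfl i
    fin_cases j
    · exact key.1
    · exact key.2
  -- no saturation
  have hclaim : ∀ n, (∀ i, |e (n + 1) 0 i| ≤ 1 / 2 * (p₀ * γ ^ n)) ∧
      (∀ i, |e (n + 2) 0 i| ≤ 1 / 2 * (p₀ * γ ^ (n + 1))) ∧
      (∀ i, |u (n + 1) i| ≤ 1 / 8 * (p₀ * γ ^ (n + 1))) := by
    intro n
    -- Strong induction, because the disagreement bound uses the errors at all earlier times.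
    induction n using Nat.strong_induction_on with
    | _ n ih =>
    rcases n with _ | n
    · refine ⟨he0_one, he0_two, fun i => ?_⟩
      rw [hu1 (0 + 1) le_rfl i, abs_zero]
      have := hp (0 + 1)
      positivity
    · obtain ⟨h₁, h₂, h₃⟩ := ih n (Nat.lt_succ_self n)
      have herrs : ∀ m ≤ n, ∀ i j, |e (m + 2) j i| ≤ D * (p₀ * γ ^ m) := fun m hm => by
        obtain ⟨k₁, k₂, k₃⟩ := ih m (by omega)
        exact herr m k₁ k₂ k₃
      have hdn := hdis n fun m hm => herrs m hm.le
      have hpn := hp n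
      have hp1 : p₀ * γ ^ (n + 1) = γ * (p₀ * γ ^ n) := by ring
      have hp2 : p₀ * γ ^ (n + 2) = γ * γ * (p₀ * γ ^ n) := by ring
      have hγγ : 1 / 2 ≤ γ * γ := by nlinarith
      refine ⟨h₂, fun i => ?_, fun i => ?_⟩
      · refine hq n i ?_
        rw [hp2]
        exact abs_innovation_le θ hpn.le hγ15 hγ1 (hp1 ▸ h₂ i) (h₁ i) (hp1 ▸ h₃ i)
      · change |u (n + 2) i| ≤ 1 / 8 * (p₀ * γ ^ (n + 2))
        rw [hu2 (n + 2) (by omega) i]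
        have k₁ := HΛ _ _ (fun v => abs_neg_sin_mul_add_cos_mul_le θ (hdn v 0) (hdn v 1)) i
        have k₂ := hFbound n (herrs n le_rfl) i
        refine (abs_add_le _ _).trans ?_
        rw [abs_neg, abs_mul, abs_mul, abs_of_pos hε, abs_of_pos (by positivity : 0 < ε / h)]
        calc _ ≤ ε / h * (Λ * (C * (B₀ * p₀) * γ ^ n + C * (B₀ * p₀) * γ ^ n))
              + ε * (1 / h * (Λ * (2 * D)) * (p₀ * γ ^ n)) :=
              add_le_add (mul_le_mul_of_nonneg_left k₁ (by positivity))
                (mul_le_mul_of_nonneg_left k₂ hε.le)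
          _ = ε * Q * (p₀ * γ ^ n) := by rw [hQ]; ring
          _ ≤ 1 / 16 * (p₀ * γ ^ n) := mul_le_mul_of_nonneg_right hεQ' hpn.le
          _ ≤ _ := by rw [hp2]; nlinarith
  have hCB : 0 ≤ C * B₀ := by positivity
  intro t i j
  rcases t with _ | _ | n
  · have := hd₀ i j
    rw [pow_zero]
    nlinarith
  · have := hd1 i j
    rw [zero_add, pow_one]
    have k : 2 * p₀ ≤ 2 * (C * B₀ + 4) * γ * p₀ :=
      mul_le_mul_of_nonneg_right (by nlinarith) hp₀.le
    change |d 1 j i| ≤ _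
    linarith
  · have k₁ := hdis n (fun m _ => herr m (hclaim m).1 (hclaim m).2.1 (hclaim m).2.2) i j
    have k₂ := hp n
    refine k₁.trans ?_
    have e₁ : 2 * (C * B₀ + 4) * p₀ * γ ^ (n + 1 + 1) =
        2 * (C * B₀ + 4) * (γ * γ) * (p₀ * γ ^ n) := by ring
    have e₂ : C * (B₀ * p₀) * γ ^ n = C * B₀ * (p₀ * γ ^ n) := by ring
    rw [e₁, e₂]
    have hγγ : 1 / 2 ≤ γ * γ := by nlinarith
    exact mul_le_mul_of_nonneg_right (by nlinarith) k₂.le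

/-- In the closed loop the quantizers never saturate, and disagreements decay at the rate of the
scale with a constant independent of the gain. -/
theorem exists_closedLoop_disagreement_bound [DecidableEq V] (hG : G.HasSpanningTree)
    {θ : ℝ} (hθ : Real.sin θ ≠ 0) {h : ℝ} (hpos : 0 < h)
    (hle : ∀ μ ∈ spectrum ℂ (G.laplacian.map (fun a : ℝ => (a : ℂ))), μ ≠ 0 → h ≤ μ.re)
    (hw : G.IsLeftNullVector w) :
    ∃ R ε₀ : ℝ, 0 < ε₀ ∧ ε₀ ≤ 1 / 4 ∧ ∀ ε : ℝ, 0 < ε → ε < ε₀ →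
      ∀ (p₀ : ℝ) (M : ℕ → ℕ) (x₀ : V → Fin 2 → ℝ), 0 < p₀ →
        (∀ i j, |x₀ i j| ≤ 3 / 4 * (1 - ε / 4) * p₀) →
        (∀ i j, |disagreement w x₀ j i| ≤ p₀) →
        1 ≤ M 1 → 1 ≤ M 2 →
        (∀ t, 3 ≤ t → |Real.cos θ| + 1 / 2 ≤ (M t : ℝ)) →
        ∀ t i j, |disagreement w (closedLoop G (smallGainParams θ h ε p₀ M) x₀ t).plant j i| ≤
          R * p₀ * (1 - ε / 4) ^ t := by
  obtain ⟨R, ε₀, hε₀, hε₀4, H⟩ := exists_disagreement_bound_of_unsaturated hG hθ hpos hle hw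
  refine ⟨R, ε₀, hε₀, hε₀4, ?_⟩
  intro ε hε hlt p₀ M x₀ hp₀ hx₀ hd₀ hM1 hM2 hM
  have hγ0 : 0 < 1 - ε / 4 := by linarith
  set γ : ℝ := 1 - ε / 4 with hγ
  set P := smallGainParams θ h ε p₀ M
  have hp : ∀ t, 0 < p₀ * γ ^ t := fun t => by positivity
  set S := closedLoop G P x₀
  have hsat : ∀ t i, |(S (t + 1)).plant i 0 - P.predict t ((S t).est i)| ≤
      ((M (t + 1) : ℝ) + 1 / 2) * (p₀ * γ ^ t) → |(S (t + 1)).plant i 0 - (S (t + 1)).est i 0| ≤ 1 / 2 * (p₀ * γ ^ t) :=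
    fun t i hs => abs_sub_est_le (P := P) (hp t) hs
  have hM1' : (1 : ℝ) ≤ M 1 := by exact_mod_cast hM1
  have hM2' : (1 : ℝ) ≤ M 2 := by exact_mod_cast hM2
  have hx1 : ∀ i, (S 1).plant i 0 = Real.cos θ * x₀ i 0 + Real.sin θ * x₀ i 1 :=
    fun i => plant_succ_zero G P x₀ 0 i
  have hx1' : ∀ i, (S 1).plant i 1 = -Real.sin θ * x₀ i 0 + Real.cos θ * x₀ i 1 := fun i => by
    have := plant_succ_one G P x₀ 0 i
    rw [control_of_le_one (by norm_num), add_zero] at this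
    exact this
  -- Treating two free steps as one rotation by `2 θ` costs a factor `2` instead of `4`: the output
  -- is at most `3/2 γ p₀ = (1 + 1/2) p(1)`, just the unsaturated range for one level.
  have hx2 : ∀ i, (S 2).plant i 0 = Real.cos (2 * θ) * x₀ i 0 + Real.sin (2 * θ) * x₀ i 1 :=
    fun i => by
      have : (S 2).plant i 0 = Real.cos θ * (S 1).plant i 0 + Real.sin θ * (S 1).plant i 1 :=
        plant_succ_zero G P x₀ 1 i
      rw [this, hx1, hx1', Real.cos_two_mul', Real.sin_two_mul]
      ring
  have hpred : ∀ t ≤ 1, ∀ i, P.predict t ((S t).est i) = 0 := fun t ht i =>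
    if_pos (by omega)
  have he0_one : ∀ i, |(S 1).plant i 0 - (S 1).est i 0| ≤ 1 / 2 * (p₀ * γ ^ 0) := fun i => by
    refine hsat 0 i ?_
    rw [hpred 0 (by norm_num), sub_zero, hx1]
    refine (abs_cos_mul_add_sin_mul_le θ (hx₀ i 0) (hx₀ i 1)).trans ?_
    have : (3 / 2 : ℝ) * (p₀ * γ ^ 0) ≤ ((M (0 + 1) : ℝ) + 1 / 2) * (p₀ * γ ^ 0) :=
      mul_le_mul_of_nonneg_right (by rw [zero_add]; linarith) (hp 0).le
    refine le_trans ?_ this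
    rw [pow_zero]
    nlinarith
  have he0_two : ∀ i, |(S 2).plant i 0 - (S 2).est i 0| ≤ 1 / 2 * (p₀ * γ ^ 1) := fun i => by
    refine hsat 1 i ?_
    rw [hpred 1 le_rfl, sub_zero, hx2]
    refine (abs_cos_mul_add_sin_mul_le (2 * θ) (hx₀ i 0) (hx₀ i 1)).trans ?_
    have : (3 / 2 : ℝ) * (p₀ * γ ^ 1) ≤ ((M (1 + 1) : ℝ) + 1 / 2) * (p₀ * γ ^ 1) :=
      mul_le_mul_of_nonneg_right (by linarith) (hp 1).le
    refine le_trans ?_ this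
    rw [pow_one]
    linarith
  refine H ε hε hlt p₀ (fun t => disagreement w (S t).plant)
    (fun t j i => (S t).plant i j - (S t).est i j) (fun t => control G P t (S t)) hp₀
    (fun t j => sum_mul_disagreement hw.2 _ j) (disagreement_succ_zero G P x₀ w) ?_
    (fun t ht => control_of_le_one ht _) (fun t ht => control_eq_disagreement ht)
    (fun t ht => error_one_eq (P := P) hθ ht) ?_ hd₀ he0_one he0_two
  · intro t i
    have := disagreement_succ_one G P x₀ w t i
    rwa [sum_mul_control hw, sub_zero] at this
  · intro n i hn
    refine hsat (n + 2) i ?_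
    have hinn := innovation_eq (G := G) (P := P) (x₀ := x₀) (t := n + 1) hθ (by omega) i
    refine (congrArg abs hinn).trans_le (hn.trans ?_)
    -- Here `M ≥ |cos θ| + 1/2` enters: rounding adds the other `1/2` to the unsaturated range.
    exact mul_le_mul_of_nonneg_right (by linarith [hM (n + 2 + 1) (by omega)]) (hp _).le

end Consensus

end OscillatorConsensus

/-! ### Consensus from the decay of disagreements -/

theorem theorem1 {V : Type*} [Fintype V] [DecidableEq V]
    (G : OscillatorConsensus.WeightedDigraph V) (hG : G.HasSpanningTree)
    (θ : ℝ) (hθ : Real.sin θ ≠ 0)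
    (h : ℝ) (hpos : 0 < h)
    (hle : ∀ μ ∈ spectrum ℂ (G.laplacian.map (fun a : ℝ => (a : ℂ))), μ ≠ 0 → h ≤ μ.re)
    (w : V → ℝ) (hw : G.IsLeftNullVector w) :
    (∃ ε₀ : ℝ, 0 < ε₀ ∧ ∀ ε : ℝ, 0 < ε → ε < ε₀ →
      0 < 1 - ε / 4 ∧
      ∃ κ : ℝ, ∀ (Cx Cδ p₀ : ℝ) (M : ℕ → ℕ) (x₀ : V → Fin 2 → ℝ),
        0 < Cx → 0 < Cδ →
        (∀ i j, |x₀ i j| ≤ Cx) →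
        (∀ i j, |x₀ i j - ∑ v, w v * x₀ v j| ≤ Cδ) →
        max (4 / (3 * (1 - ε / 4)) * Cx) Cδ ≤ p₀ →
        1 ≤ M 1 → 1 ≤ M 2 →
        (∀ t, 3 ≤ t → |Real.cos θ| + 1 / 2 ≤ (M t : ℝ)) →
        let x : ℕ → V → Fin 2 → ℝ := fun t =>
          (OscillatorConsensus.closedLoop G
            (OscillatorConsensus.smallGainParams θ h ε p₀ M) x₀ t).plant
        (∀ i v j, Tendsto (fun t => x t i j - x t v j) atTop (𝓝 0)) ∧
        ∀ t i v j, |x t i j - x t v j| ≤ κ * p₀ * (1 - ε / 4) ^ t) ∧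
    (IsLeast {K : ℕ | 1 ≤ K ∧ |Real.cos θ| + 1 / 2 ≤ (K : ℝ)} ⌈|Real.cos θ| + 1 / 2⌉₊ ∧
      IsLeast {b : ℕ | OscillatorConsensus.SignalsFitIn ⌈|Real.cos θ| + 1 / 2⌉₊ b}
        ⌈Real.logb 2 (2 * (⌈|Real.cos θ| + 1 / 2⌉₊ : ℝ))⌉₊ ∧
      ⌈Real.logb 2 (2 * (⌈|Real.cos θ| + 1 / 2⌉₊ : ℝ))⌉₊ ≤ 2) := by
  refine ⟨?_, OscillatorConsensus.quantization_levels hθ⟩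
  obtain ⟨R, ε₀, hε₀, hε₀4, H⟩ :=
    OscillatorConsensus.exists_closedLoop_disagreement_bound hG hθ hpos hle hw
  refine ⟨ε₀, hε₀, fun ε hε hlt => ?_⟩
  have hγ : 0 < 1 - ε / 4 := by linarith
  have hγ' := hγ.ne'
  -- The weighted average cancels in the difference of two agents, leaving two disagreements.
  refine ⟨hγ, 2 * R, ?_⟩
  intro Cx Cδ p₀ M x₀ hCx hCδ hx₀ hd₀ hp₀ hM1 hM2 hM x
  obtain ⟨hpx, hpd⟩ := max_le_iff.1 hp₀
  have hp₀pos : 0 < p₀ := hCδ.trans_le hpd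
  have hpx' : Cx ≤ 3 / 4 * (1 - ε / 4) * p₀ := by
    have := mul_le_mul_of_nonneg_left hpx (by positivity : 0 ≤ 3 / 4 * (1 - ε / 4))
    calc Cx = 3 / 4 * (1 - ε / 4) * (4 / (3 * (1 - ε / 4)) * Cx) := by
          generalize 1 - ε / 4 = γ at hγ'
          field_simp
      _ ≤ _ := this
  have hdis := H ε hε hlt p₀ M x₀ hp₀pos (fun i j => (hx₀ i j).trans hpx')
    (fun i j => (hd₀ i j).trans hpd) hM1 hM2 hM
  have hbound : ∀ t i v j, |x t i j - x t v j| ≤ 2 * R * p₀ * (1 - ε / 4) ^ t := by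
    intro t i v j
    have h₁ := hdis t i j
    have h₂ := hdis t v j
    have h₃ := abs_sub (OscillatorConsensus.disagreement w (x t) j i)
      (OscillatorConsensus.disagreement w (x t) j v)
    simp only [OscillatorConsensus.disagreement, sub_sub_sub_cancel_right] at h₁ h₂ h₃
    linarith
  refine ⟨fun i v j => ?_, hbound⟩
  refine squeeze_zero_norm (hbound · i v j) ?_
  have := (tendsto_pow_atTop_nhds_zero_of_lt_one hγ.le (by linarith)).const_mul (2 * R * p₀)
  rwa [mul_zero] at this
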